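/- Let $n\ge 1$, $q\ge 0$ be integers. Let $g$ be a density generator in dimension $n$, i.e. a measurable function, nonnegative on $[0,\infty)$, with $0<\int_0^\infty z^{n/2-1}g(z)\,dz<\infty$. For a positive definite $n\times n$ matrix $\Sigma$, $X\sim ELL_n(0,\Sigma,g)$ means that $X$ has density $x\mapsto \frac{c_n}{\sqrt{\det\Sigma}}\,g(x^{T}\Sigma^{-1}x)$ on $\mathbb R^n$, where $c_n=\frac{\Gamma(n/2)}{\pi^{n/2}}\left(\int_0^\infty z^{n/2-1}g(z)\,dz\right)^{-1}$. Let $\alpha,\beta:\mathbb R^q\to[0,\infty)$ be measurable and $H$ a probability distribution on $\mathbb R^q$. For $\mu,\delta\in\mathbb R^n$, $Y\sim LSE_n(\mu,\Sigma,\delta,g,\alpha,\beta,H)$ means that $Y$ has the same distribution as $\mu+\alpha(Z)X+\beta(Z)\delta$, where $X\sim ELL_n(0,\Sigma,g)$ and $Z\sim H$ are independent. A real $n\times n$ matrix $A$ is copositive if $x^{T}Ax\ge 0$ for every $x\in\mathbb R^n$ with nonnegative entries, and completely positive if $A=B^{T}B$ for some $m$ and some $m\times n$ matrix $B$ with nonnegative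 entries. Write $Y_1\le_{cp}Y_2$ if $E f(Y_1)\le E f(Y_2)$ for every twice continuously differentiable $f:\mathbb R^n\to\mathbb R$ whose Hessian is completely positive at every point, whenever the two expectations are well defined (as extended real numbers, i.e. not of the form $\infty-\infty$). Let $Y_1\sim LSE_n(\mu_1,\Sigma_1,\delta_1,g,\alpha,\beta,H)$ and $Y_2\sim LSE_n(\mu_2,\Sigma_2,\delta_2,g,\alpha,\beta,H)$, with $\Sigma_1,\Sigma_2$ positive definite. Then: 1. If $\mu_1=\mu_2$, $\delta_1=\delta_2$ and $\Sigma_2-\Sigma_1$ is copositive, then $Y_1\le_{cp}Y_2$. 2. Suppose that $Y_1$ and $Y_2$ have a mean vector and a covariance matrix (i.e. $E\|Y_1\|^2,E\|Y_2\|^2<\infty$), and that neither $\alpha$ nor $\beta$ is $H$-almost everywhere zero. If $\mu_1=\mu_2$, then $Y_1\le_{cp}Y_2$ if and only if $\delta_1=\delta_2$ and $\Sigma_2-\Sigma_1$ is copositive. 3. Suppose that $Y_1$ and $Y_2$ have a mean vector and a covariance matrix, and that $\alpha$ is not $H$-almost everywhere zero. If $\delta_1=\delta_2$, then $Y_1\le_{cp}Y_2$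 if and only if $\mu_1=\mu_2$ and $\Sigma_2-\Sigma_1$ is copositive. -/

import Mathlib

open MeasureTheory ProbabilityTheory Set

noncomputable section

namespace LSE

/-- A real square matrix is copositive if its quadratic form is nonnegative on the nonnegative
orthant. -/
def Copositive {n : ℕ} (A : Matrix (Fin n) (Fin n) ℝ) : Prop :=
  ∀ x : Fin n → ℝ, (∀ i, 0 ≤ x i) → 0 ≤ x ⬝ᵥ (A.mulVec x)

/-- A real square matrix `A` is completely positive if `A = Bᵀ B` for some entrywise nonnegative
`m × n` matrix `B`. -/
def CompletelyPositive {n : ℕ} (A : Matrix (Fin n) (Fin n) ℝ) : Prop :=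
  ∃ (m : ℕ) (B : Matrix (Fin m) (Fin n) ℝ), (∀ i j, 0 ≤ B i j) ∧ A = B.transpose * B

/-- The Hessian matrix of second partial derivatives of `f` at `x`. -/
def hessian {n : ℕ} (f : (Fin n → ℝ) → ℝ) (x : Fin n → ℝ) : Matrix (Fin n) (Fin n) ℝ :=
  Matrix.of fun i j =>
    fderiv ℝ (fun y => fderiv ℝ f y (Pi.single j 1)) x (Pi.single i 1)

/-- The expectation of a real random variable, as the extended real `E[X⁺] - E[X⁻]`. It is
meaningful when `HasExpectation X P` holds. -/
def expectation {Ω : Type*} [MeasurableSpace Ω] (X : Ω → ℝ) (P : Measure Ω) : EReal :=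
  ((∫⁻ ω, ENNReal.ofReal (X ω) ∂P : ENNReal) : EReal)
    - ((∫⁻ ω, ENNReal.ofReal (-X ω) ∂P : ENNReal) : EReal)

/-- The expectation of `X` is well defined (possibly infinite): `X` is measurable up to null sets,
and `E[X⁺]` and `E[X⁻]` are not both infinite. -/
def HasExpectation {Ω : Type*} [MeasurableSpace Ω] (X : Ω → ℝ) (P : Measure Ω) : Prop :=
  AEMeasurable X P ∧
    (∫⁻ ω, ENNReal.ofReal (X ω) ∂P ≠ ⊤ ∨ ∫⁻ ω, ENNReal.ofReal (-X ω) ∂P ≠ ⊤)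

theorem hasExpectation_of_integrable {Ω : Type*} [MeasurableSpace Ω] {X : Ω → ℝ}
    {P : Measure Ω} (h : Integrable X P) : HasExpectation X P :=
  ⟨h.aemeasurable, Or.inl h.lintegral_lt_top.ne⟩

theorem expectation_eq_integral {Ω : Type*} [MeasurableSpace Ω] {X : Ω → ℝ}
    {P : Measure Ω} (h : Integrable X P) :
    expectation X P = ((∫ ω, X ω ∂P : ℝ) : EReal) := by
  have h1 : ∫⁻ ω, ENNReal.ofReal (X ω) ∂P ≠ ⊤ := h.lintegral_lt_top.ne
  have h2 : ∫⁻ ω, ENNReal.ofReal (-X ω) ∂P ≠ ⊤ := h.neg.lintegral_lt_top.ne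
  rw [integral_eq_lintegral_pos_part_sub_lintegral_neg_part h, EReal.coe_sub,
    EReal.coe_ennreal_toReal h1, EReal.coe_ennreal_toReal h2, expectation]

/-- The order `Y₁ ≤_cp Y₂`: `E f(Y₁) ≤ E f(Y₂)` for all twice continuously differentiable `f`
whose Hessian is everywhere completely positive, whenever the two expectations are well defined. -/
def CPOrder {n : ℕ} {Ω₁ Ω₂ : Type*} [MeasurableSpace Ω₁] [MeasurableSpace Ω₂]
    (Y₁ : Ω₁ → Fin n → ℝ) (P₁ : Measure Ω₁) (Y₂ : Ω₂ → Fin n → ℝ) (P₂ : Measure Ω₂) : Prop :=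
  ∀ f : (Fin n → ℝ) → ℝ, ContDiff ℝ 2 f → (∀ x, CompletelyPositive (hessian f x)) →
    HasExpectation (fun ω => f (Y₁ ω)) P₁ → HasExpectation (fun ω => f (Y₂ ω)) P₂ →
      expectation (fun ω => f (Y₁ ω)) P₁ ≤ expectation (fun ω => f (Y₂ ω)) P₂

/-- `g` is a density generator in dimension `n`: it is nonnegative on `[0, ∞)` and
`0 < ∫₀^∞ z^(n/2-1) g(z) dz < ∞`. -/
structure IsDensityGenerator (n : ℕ) (g : ℝ → ℝ) : Prop where
  measurable : Measurable g
  nonneg : ∀ u, 0 ≤ u → 0 ≤ g u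
  integrable : IntegrableOn (fun z : ℝ => z ^ ((n : ℝ) / 2 - 1) * g z) (Ioi 0)
  integral_pos : 0 < ∫ z in Ioi (0 : ℝ), z ^ ((n : ℝ) / 2 - 1) * g z

/-- The normalizing constant of an elliptical density. -/
def normalizingConst (n : ℕ) (g : ℝ → ℝ) : ℝ :=
  Real.Gamma ((n : ℝ) / 2) / Real.pi ^ ((n : ℝ) / 2)
    * (∫ z in Ioi (0 : ℝ), z ^ ((n : ℝ) / 2 - 1) * g z)⁻¹

/-- The elliptical distribution `ELL_n(μ, S, g)`, with location `μ`, positive definite scale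
matrix `S` and density generator `g`. -/
def ellipticalMeasure {n : ℕ} (μ : Fin n → ℝ) (S : Matrix (Fin n) (Fin n) ℝ) (g : ℝ → ℝ) :
    Measure (Fin n → ℝ) :=
  volume.withDensity fun x => ENNReal.ofReal
    (normalizingConst n g / Real.sqrt S.det * g ((x - μ) ⬝ᵥ (S⁻¹.mulVec (x - μ))))

/-- The location-scale mixture of elliptical distributions `LSE_n(μ, S, δ, g, α, β, H)`: the law
of `μ + α(Z) X + β(Z) δ`, where `X ∼ ELL_n(0, S, g)` and `Z ∼ H` are independent. -/
def lseMeasure {n q : ℕ} (μ : Fin n → ℝ) (S : Matrix (Fin n) (Fin n) ℝ) (δ : Fin n → ℝ)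
    (g : ℝ → ℝ) (α β : (Fin q → ℝ) → ℝ) (H : Measure (Fin q → ℝ)) : Measure (Fin n → ℝ) :=
  ((ellipticalMeasure 0 S g).prod H).map fun p => μ + α p.2 • p.1 + β p.2 • δ

end LSE

end

noncomputable section

namespace LSE

open Matrix Filter Topology
open scoped NNReal ENNReal BoundedContinuousFunction

/-! Factor `S₁ = B Bᵀ` and `S₂ = B diag(d) Bᵀ` with the same `B`. Both mixtures are then functions
of one pair `(w, z)`, with `w` spherical and `z ∼ H`; their scale parts differ only by a
coordinatewise rescaling of `w` by `√d`.

Sufficiency: fix `z`, put `F(w) = f(c + aBw)` and rescale `w` by `σᵢ(t) = √(1 + t(dᵢ - 1))`. Since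
`-ψ(w·w) w` is the gradient of `P(w·w)` with `P(u) = ½ ∫_u^M ψ`, the `t`-derivative of `∫ ψ(w·w)
F(σ(t)w) dw` can be integrated by parts. It equals half the integral of `P(w·w) ∑ (dᵢ - 1)
∂ᵢᵢF(σ(t)w)`, and that sum is `a² tr((S₂ - S₁) Hess f)`, nonnegative because a copositive matrix
pairs nonnegatively with a completely positive one (`integral_radial_le_integral_scaled`,
`trace_mul_nonneg_of_copositive`). The generator `g` is merely measurable, so the inequality passes
from continuous weights to `g` through a comparison of measures on the line
(`setIntegral_radial_nonneg`). The growth of `f` is arbitrary, so everything is truncated to `w·w,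
α, β ≤ N`, which keeps the weight radial, and `N → ∞` (`tendsto_expectation_restrict`).

Necessity: `v·y` and its negative have zero Hessian, so means agree. As `w` is symmetric, the mean
sees only `μ + β(z)δ`, which yields `δ₁ = δ₂` or `μ₁ = μ₂`. For `v ≥ 0`, `(v·y)²` has Hessian
`2vvᵀ`; its expectation is a term common to both laws plus `κ E[α²] vᵀSv` with `κ E[α²] > 0`, so `S₂
- S₁` is copositive. -/

/-! ### Reduction to a spherical law -/

/-- Two positive definite matrices are simultaneously diagonalized by a congruence. -/
theorem exists_simultaneous_diagonalization {n : ℕ} {S₁ S₂ : Matrix (Fin n) (Fin n) ℝ}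
    (h₁ : S₁.PosDef) (h₂ : S₂.PosDef) :
    ∃ (B : Matrix (Fin n) (Fin n) ℝ) (d : Fin n → ℝ), B.det ≠ 0 ∧ (∀ i, 0 < d i) ∧
      S₁ = B * Bᵀ ∧ S₂ = B * diagonal d * Bᵀ := by
  obtain ⟨y, hy⟩ : ∃ y : Matrix (Fin n) (Fin n) ℝ, S₁ = yᵀ * y := by
    open scoped MatrixOrder in
    obtain ⟨y, hy⟩ := CStarAlgebra.nonneg_iff_eq_star_mul_self.mp h₁.posSemidef.nonneg
    exact ⟨y, by simpa [star_eq_conjTranspose] using hy⟩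
  have hdet : y.det ≠ 0 := by
    intro h0
    have := h₁.det_pos
    simp [hy, h0] at this
  have hdet' : yᵀ.det ≠ 0 := by simpa using hdet
  have hu : IsUnit yᵀ.det := isUnit_iff_ne_zero.mpr hdet'
  -- `C` whitens `S₁`. An orthogonal `U` diagonalizing `C S₂ Cᵀ` leaves the whitened `S₁` equal to
  -- the identity, so `yᵀ U` serves both matrices.
  set C := (yᵀ)⁻¹ with hC
  have hCu : IsUnit C := (isUnit_iff_isUnit_det _).2 (by rw [hC]; exact isUnit_nonsing_inv_det _ hu)
  have hT : (C * S₂ * Cᵀ).PosDef := by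
    have := (IsUnit.posDef_star_right_conjugate_iff (x := S₂) hCu).2 h₂
    simpa [star_eq_conjTranspose] using this
  set U : Matrix (Fin n) (Fin n) ℝ := (hT.1.eigenvectorUnitary).1 with hU
  have hUU : U * Uᵀ = 1 := by
    have := Unitary.coe_mul_star_self hT.1.eigenvectorUnitary
    simpa [star_eq_conjTranspose] using this
  have hspec : C * S₂ * Cᵀ = U * diagonal hT.1.eigenvalues * Uᵀ := by
    conv_lhs => rw [hT.1.spectral_theorem]
    rw [Unitary.conjStarAlgAut_apply]
    simp [star_eq_conjTranspose, hU]
  refine ⟨yᵀ * U, hT.1.eigenvalues, ?_, hT.eigenvalues_pos, ?_, ?_⟩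
  · rw [det_mul]
    refine mul_ne_zero hdet' fun h0 => ?_
    have := congrArg det hUU
    simp [h0] at this
  · rw [transpose_mul, transpose_transpose, Matrix.mul_assoc, ← Matrix.mul_assoc U, hUU,
      Matrix.one_mul, hy]
  · have e1 : yᵀ * C = 1 := mul_nonsing_inv _ hu
    have e2 : Cᵀ * y = 1 := by
      have := congrArg transpose e1
      simpa using this
    calc S₂ = (yᵀ * C) * S₂ * (Cᵀ * y) := by rw [e1, e2]; simp
      _ = yᵀ * (C * S₂ * Cᵀ) * y := by simp only [Matrix.mul_assoc]
      _ = yᵀ * (U * diagonal hT.1.eigenvalues * Uᵀ) * y :=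
        congrArg (fun X => yᵀ * X * y) hspec
      _ = _ := by simp only [transpose_mul, transpose_transpose, Matrix.mul_assoc]

theorem measurable_mulVec {m n : ℕ} (B : Matrix (Fin m) (Fin n) ℝ) : Measurable (B.mulVec) :=
  (Continuous.matrix_mulVec continuous_const continuous_id).measurable

theorem ellipticalMeasure_zero_one {n : ℕ} (g : ℝ → ℝ) :
    ellipticalMeasure 0 (1 : Matrix (Fin n) (Fin n) ℝ) g =
      volume.withDensity fun x => ENNReal.ofReal (normalizingConst n g * g (x ⬝ᵥ x)) := by
  simp [ellipticalMeasure]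

/-- An elliptical distribution is the image of a spherical one under a linear map. -/
theorem ellipticalMeasure_mul_transpose {n : ℕ} (B : Matrix (Fin n) (Fin n) ℝ) (hB : B.det ≠ 0)
    {g : ℝ → ℝ} (hg : Measurable g) :
    ellipticalMeasure 0 (B * Bᵀ) g = (ellipticalMeasure 0 1 g).map B.mulVec := by
  have hBu : IsUnit B.det := isUnit_iff_ne_zero.mpr hB
  have hBm := measurable_mulVec B
  have hvol : (volume : Measure (Fin n → ℝ)) = ENNReal.ofReal |B.det| • volume.map B.mulVec := by
    have h := Real.map_matrix_volume_pi_eq_smul_volume_pi hB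
    have h' : (⇑(toLin' B) : (Fin n → ℝ) → (Fin n → ℝ)) = B.mulVec := by
      ext1 x; simp
    rw [h'] at h
    rw [h, smul_smul, ← ENNReal.ofReal_mul (abs_nonneg _), ← abs_mul, mul_inv_cancel₀ hB]
    simp
  have hm : Measurable fun x : Fin n → ℝ => ENNReal.ofReal
      (normalizingConst n g / Real.sqrt (B * Bᵀ).det *
        g (x ⬝ᵥ ((B * Bᵀ)⁻¹.mulVec x))) := by
    have : Continuous fun x : Fin n → ℝ => x ⬝ᵥ ((B * Bᵀ)⁻¹.mulVec x) := by
      fun_prop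
    exact ((hg.comp this.measurable).const_mul _).ennreal_ofReal
  have hm1 : Measurable fun x : Fin n → ℝ =>
      ENNReal.ofReal (normalizingConst n g * g (x ⬝ᵥ x)) := by
    have : Continuous fun x : Fin n → ℝ => x ⬝ᵥ x := by fun_prop
    exact ((hg.comp this.measurable).const_mul _).ennreal_ofReal
  ext s hs
  rw [ellipticalMeasure_zero_one, Measure.map_apply hBm hs, withDensity_apply _ (hBm hs),
    ellipticalMeasure, withDensity_apply _ hs]
  simp only [sub_zero]
  conv_lhs => rw [hvol]
  rw [Measure.restrict_smul, lintegral_smul_measure, setLIntegral_map hs hm hBm, smul_eq_mul,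
    ← lintegral_const_mul _ (by exact hm.comp hBm)]
  refine lintegral_congr fun w => ?_
  rw [← ENNReal.ofReal_mul (abs_nonneg _)]
  congr 1
  have hq : (B *ᵥ w) ⬝ᵥ ((B * Bᵀ)⁻¹ *ᵥ (B *ᵥ w)) = w ⬝ᵥ w := by
    rw [Matrix.mul_inv_rev, mulVec_mulVec, Matrix.mul_assoc, nonsing_inv_mul _ hBu, Matrix.mul_one,
      dotProduct_mulVec, ← mulVec_transpose, transpose_nonsing_inv, transpose_transpose,
      mulVec_mulVec, nonsing_inv_mul _ hBu, one_mulVec]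
  have hs' : Real.sqrt (B * Bᵀ).det = |B.det| := by
    rw [det_mul, det_transpose, Real.sqrt_mul_self_eq_abs]
  rw [hq, hs']
  field_simp

theorem lseMeasure_mul_transpose {n q : ℕ} (μ δ : Fin n → ℝ) (B : Matrix (Fin n) (Fin n) ℝ)
    (hB : B.det ≠ 0) {g : ℝ → ℝ} (hg : Measurable g) {α β : (Fin q → ℝ) → ℝ} (hα : Measurable α)
    (hβ : Measurable β) (H : Measure (Fin q → ℝ)) [SFinite H] :
    lseMeasure μ (B * Bᵀ) δ g α β H =
      ((ellipticalMeasure 0 1 g).prod H).map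
        fun p => μ + α p.2 • B.mulVec p.1 + β p.2 • δ := by
  have hBm := measurable_mulVec B
  have : SFinite (ellipticalMeasure 0 (1 : Matrix (Fin n) (Fin n) ℝ) g) := by
    rw [ellipticalMeasure]; infer_instance
  rw [lseMeasure, ellipticalMeasure_mul_transpose B hB hg]
  -- Writing `H` as its own image under the identity turns the product of images into the image of a
  -- product.
  conv_lhs => rw [← Measure.map_id (μ := H), Measure.map_prod_map _ _ hBm measurable_id]
  rw [Measure.map_map (by fun_prop) (by fun_prop)]
  rfl

/-! ### Radial weights: differentiation and integration by parts -/

theorem isCompact_dotProduct_self_le (n : ℕ) (M : ℝ) :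
    IsCompact {w : Fin n → ℝ | w ⬝ᵥ w ≤ M} := by
  refine Metric.isCompact_of_isClosed_isBounded
    (isClosed_le (by fun_prop) continuous_const) ?_
  refine (Metric.isBounded_closedBall (x := (0 : Fin n → ℝ)) (r := Real.sqrt M)).subset ?_
  intro w hw
  rw [mem_closedBall_zero_iff, pi_norm_le_iff_of_nonneg (Real.sqrt_nonneg _)]
  intro i
  rw [Real.norm_eq_abs]
  refine Real.abs_le_sqrt (le_trans ?_ hw)
  rw [sq]
  exact Finset.single_le_sum (f := fun i => w i * w i) (fun j _ => mul_self_nonneg (w j))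
    (Finset.mem_univ i)

/-- A continuous function vanishing off a Euclidean ball has compact support. -/
theorem hasCompactSupport_of_dotProduct_self {n : ℕ} {E : Type*} [Zero E] {k : (Fin n → ℝ) → E}
    {M : ℝ} (hk : ∀ w, M ≤ w ⬝ᵥ w → k w = 0) : HasCompactSupport k :=
  HasCompactSupport.intro (isCompact_dotProduct_self_le n M) fun w hw =>
    hk w (le_of_not_ge hw)

theorem integrable_of_dotProduct_self {n : ℕ} {E : Type*} [NormedAddCommGroup E]
    {k : (Fin n → ℝ) → E} (hc : Continuous k)
    {M : ℝ} (hk : ∀ w, M ≤ w ⬝ᵥ w → k w = 0) : Integrable k :=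
  hc.integrable_of_hasCompactSupport (hasCompactSupport_of_dotProduct_self hk)

/-- Multiplication by a fixed vector, as a continuous linear map of the scaling vector. -/
def mulRightCLM {n : ℕ} (w : Fin n → ℝ) : (Fin n → ℝ) →L[ℝ] (Fin n → ℝ) :=
  (ContinuousLinearMap.mul ℝ (Fin n → ℝ)).flip w

@[simp] theorem mulRightCLM_apply {n : ℕ} (w s : Fin n → ℝ) : mulRightCLM w s = s * w := rfl

theorem continuous_mulRightCLM {n : ℕ} : Continuous (mulRightCLM (n := n)) :=
  (ContinuousLinearMap.mul ℝ (Fin n → ℝ)).flip.continuous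

/-- Differentiation of an integral with respect to a coordinatewise scaling. -/
theorem hasFDerivAt_integral_mul_dotProduct {n : ℕ} {F : (Fin n → ℝ) → ℝ} (hF : ContDiff ℝ 1 F)
    {ψ : ℝ → ℝ} (hψ : Continuous ψ) {M : ℝ} (hM : ∀ r, M ≤ r → ψ r = 0) (s : Fin n → ℝ) :
    HasFDerivAt (fun s : Fin n → ℝ => ∫ w, ψ (w ⬝ᵥ w) * F (s * w))
      (∫ w, ψ (w ⬝ᵥ w) • (fderiv ℝ F (s * w)).comp (mulRightCLM w)) s := by
  have hF' : Continuous (fderiv ℝ F) := hF.continuous_fderiv one_ne_zero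
  have hFc : Continuous F := hF.continuous
  have hQ : Continuous fun w : Fin n → ℝ => w ⬝ᵥ w := by fun_prop
  have hcont : Continuous fun p : (Fin n → ℝ) × (Fin n → ℝ) =>
      ψ (p.2 ⬝ᵥ p.2) • (fderiv ℝ F (p.1 * p.2)).comp (mulRightCLM p.2) := by
    refine (hψ.comp (hQ.comp continuous_snd)).smul ?_
    exact (hF'.comp (by fun_prop : Continuous fun p : (Fin n → ℝ) × (Fin n → ℝ) =>
      p.1 * p.2)).clm_comp (continuous_mulRightCLM.comp continuous_snd)
  -- Joint continuity bounds the derivative for `s'` near `s` and `w·w ≤ M`; outside, `ψ` vanishes.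
  -- This gives the dominating function.
  have hcpt : IsCompact (Metric.closedBall s 1 ×ˢ {w : Fin n → ℝ | w ⬝ᵥ w ≤ M}) :=
    (isCompact_closedBall s 1).prod (isCompact_dotProduct_self_le n M)
  obtain ⟨C, hC⟩ := hcpt.exists_bound_of_continuousOn hcont.continuousOn
  refine hasFDerivAt_integral_of_dominated_of_fderiv_le (𝕜 := ℝ)
    (F := fun s w : Fin n → ℝ => ψ (w ⬝ᵥ w) * F (s * w))
    (F' := fun s w : Fin n → ℝ => ψ (w ⬝ᵥ w) • (fderiv ℝ F (s * w)).comp (mulRightCLM w))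
    (Metric.ball_mem_nhds s one_pos)
    (bound := {w : Fin n → ℝ | w ⬝ᵥ w ≤ M}.indicator fun _ => C) ?_ ?_ ?_ ?_ ?_ ?_
  · exact Eventually.of_forall fun s' =>
      ((hψ.comp hQ).mul (hFc.comp
        (by fun_prop : Continuous fun w : Fin n → ℝ => s' * w))).aestronglyMeasurable
  · exact integrable_of_dotProduct_self ((hψ.comp hQ).mul (hFc.comp
      (by fun_prop : Continuous fun w : Fin n → ℝ => s * w)))
      (M := M) fun w hw => by simp [hM _ hw]
  · exact (hcont.comp (by fun_prop : Continuous fun w : Fin n → ℝ => (s, w))).aestronglyMeasurable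
  · refine ae_of_all _ fun w s' hs' => ?_
    by_cases hw : w ⬝ᵥ w ≤ M
    · rw [indicator_of_mem (by exact hw)]
      exact hC (s', w) ⟨Metric.ball_subset_closedBall hs', hw⟩
    · rw [indicator_of_notMem (by exact hw), hM _ (le_of_not_ge hw)]
      simp
  · rw [integrable_indicator_iff (isCompact_dotProduct_self_le n M).measurableSet]
    exact integrableOn_const (isCompact_dotProduct_self_le n M).measure_lt_top.ne
  · refine ae_of_all _ fun w s' _ => ?_
    have h1 : HasFDerivAt F (fderiv ℝ F (s' * w)) (mulRightCLM w s') :=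
      (hF.differentiable one_ne_zero _).hasFDerivAt
    have h2 := h1.comp s' (mulRightCLM w).hasFDerivAt
    exact h2.const_mul (ψ (w ⬝ᵥ w))

/-- This potential, evaluated at `w·w`, has gradient `-ψ(w·w) w`; the factor one half absorbs the 2
from differentiating `w·w`. -/
theorem hasDerivAt_half_integral_tail {ψ : ℝ → ℝ} (hψ : Continuous ψ) (M u : ℝ) :
    HasDerivAt (fun u => (∫ r in u..M, ψ r) / 2) (-ψ u / 2) u :=
  (intervalIntegral.integral_hasDerivAt_left (hψ.intervalIntegrable _ _)
    (hψ.stronglyMeasurableAtFilter _ _) hψ.continuousAt).div_const 2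

theorem continuous_half_integral_tail {ψ : ℝ → ℝ} (hψ : Continuous ψ) (M : ℝ) :
    Continuous fun u => (∫ r in u..M, ψ r) / 2 :=
  continuous_iff_continuousAt.2 fun u => (hasDerivAt_half_integral_tail hψ M u).continuousAt

theorem integral_tail_eq_zero {ψ : ℝ → ℝ} {M : ℝ} (hM : ∀ r, M ≤ r → ψ r = 0) {u : ℝ}
    (hu : M ≤ u) : (∫ r in u..M, ψ r) = 0 := by
  rw [intervalIntegral.integral_congr (g := fun _ => (0 : ℝ)), intervalIntegral.integral_zero]
  intro r hr
  rw [uIcc_of_ge hu] at hr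
  exact hM r hr.1

/-- Integration by parts against a radial density. -/
theorem integral_radial_by_parts {n : ℕ} {G : (Fin n → ℝ) → ℝ} (hG : ContDiff ℝ 1 G)
    {ψ : ℝ → ℝ} (hψ : Continuous ψ) {M : ℝ} (hM : ∀ r, M ≤ r → ψ r = 0) (s : Fin n → ℝ)
    (i : Fin n) :
    ∫ w, ψ (w ⬝ᵥ w) * (w i * G (s * w)) =
      ∫ w : Fin n → ℝ, s i * fderiv ℝ G (s * w) (Pi.single i 1) *
        ((∫ r in (w ⬝ᵥ w)..M, ψ r) / 2) := by
  have hQ : Continuous fun w : Fin n → ℝ => w ⬝ᵥ w := by fun_prop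
  have hG' : Continuous (fderiv ℝ G) := hG.continuous_fderiv one_ne_zero
  have hGd : Differentiable ℝ G := hG.differentiable one_ne_zero
  have hP := hasDerivAt_half_integral_tail hψ M
  have hP0 : ∀ u, M ≤ u → (∫ r in u..M, ψ r) = 0 := fun u hu => integral_tail_eq_zero hM hu
  have hPc := continuous_half_integral_tail hψ M
  have hsw : ∀ w : Fin n → ℝ, HasFDerivAt (fun w : Fin n → ℝ => s * w)
      (ContinuousLinearMap.mul ℝ (Fin n → ℝ) s) w := fun w =>
    (ContinuousLinearMap.mul ℝ (Fin n → ℝ) s).hasFDerivAt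
  have hGs : ∀ w : Fin n → ℝ, HasFDerivAt (fun w : Fin n → ℝ => G (s * w))
      ((fderiv ℝ G (s * w)).comp (ContinuousLinearMap.mul ℝ (Fin n → ℝ) s)) w := fun w =>
    HasFDerivAt.comp (g := G) w (hGd (s * w)).hasFDerivAt (hsw w)
  have e1 : ∀ w : Fin n → ℝ, fderiv ℝ (fun w : Fin n → ℝ => G (s * w)) w (Pi.single i 1) =
      s i * fderiv ℝ G (s * w) (Pi.single i 1) := fun w => by
    rw [(hGs w).fderiv, ContinuousLinearMap.comp_apply, ContinuousLinearMap.mul_apply',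
      show s * (Pi.single i 1 : Fin n → ℝ) = s i • Pi.single i 1 by
        ext j; by_cases h : j = i <;> simp [h], map_smul, smul_eq_mul]
  have hQd : ∀ w : Fin n → ℝ, HasFDerivAt (fun w : Fin n → ℝ => w ⬝ᵥ w)
      (∑ j, (w j • ContinuousLinearMap.proj (R := ℝ) (φ := fun _ : Fin n => ℝ) j +
        w j • ContinuousLinearMap.proj (R := ℝ) (φ := fun _ : Fin n => ℝ) j)) w := fun w => by
    have : ∀ j ∈ Finset.univ, HasFDerivAt (fun w : Fin n → ℝ => w j * w j)
      (w j • ContinuousLinearMap.proj (R := ℝ) (φ := fun _ : Fin n => ℝ) j +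
        w j • ContinuousLinearMap.proj (R := ℝ) (φ := fun _ : Fin n => ℝ) j) w := fun j _ =>
      HasFDerivAt.mul (hasFDerivAt_apply j w) (hasFDerivAt_apply j w)
    simpa [dotProduct] using HasFDerivAt.fun_sum this
  have hPQ : ∀ w : Fin n → ℝ, HasFDerivAt
      (fun w : Fin n → ℝ => (∫ r in (w ⬝ᵥ w)..M, ψ r) / 2) _ w := fun w =>
    HasDerivAt.comp_hasFDerivAt (f := fun w : Fin n → ℝ => w ⬝ᵥ w) w (hP (w ⬝ᵥ w)) (hQd w)
  have e2 : ∀ w : Fin n → ℝ,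
      fderiv ℝ (fun w : Fin n → ℝ => (∫ r in (w ⬝ᵥ w)..M, ψ r) / 2) w (Pi.single i 1) =
        -(ψ (w ⬝ᵥ w) * w i) := fun w => by
    rw [(hPQ w).fderiv]
    simp only [_root_.smul_apply, _root_.sum_apply,
      _root_.add_apply, ContinuousLinearMap.proj_apply, smul_eq_mul,
      Pi.single_apply, mul_ite, mul_one, mul_zero]
    rw [Finset.sum_add_distrib]
    simp
    ring
  have hPd : Differentiable ℝ fun w : Fin n → ℝ => (∫ r in (w ⬝ᵥ w)..M, ψ r) / 2 := fun w =>
    (hPQ w).differentiableAt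
  have hGsc : Continuous fun w : Fin n → ℝ => G (s * w) := hG.continuous.comp (by fun_prop)
  have hGsc' : Continuous fun w : Fin n → ℝ => fderiv ℝ G (s * w) (Pi.single i 1) :=
    (hG'.comp (by fun_prop : Continuous fun w : Fin n → ℝ => s * w)).clm_apply continuous_const
  -- The weight and its potential both vanish for `w·w ≥ M`, so all products are integrable and no
  -- boundary term appears.
  have key := integral_mul_fderiv_eq_neg_fderiv_mul_of_integrable (μ := volume)
    (f := fun w : Fin n → ℝ => G (s * w))
    (g := fun w : Fin n → ℝ => (∫ r in (w ⬝ᵥ w)..M, ψ r) / 2) (v := Pi.single i 1)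
    (by
      simp only [e1]
      exact integrable_of_dotProduct_self (M := M)
        ((continuous_const.mul hGsc').mul (hPc.comp hQ)) fun w hw => by simp [hP0 _ hw])
    (by
      simp only [e2]
      exact integrable_of_dotProduct_self (M := M)
        (hGsc.mul ((hψ.comp hQ).mul (continuous_apply i)).neg) fun w hw => by simp [hM _ hw])
    (integrable_of_dotProduct_self (M := M) (hGsc.mul (hPc.comp hQ))
      fun w hw => by simp [hP0 _ hw])
    (fun w _ => (hGs w).differentiableAt) (fun w _ => hPd w)
  simp only [e1, e2] at key
  rw [← neg_inj, ← key, ← integral_neg]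
  refine integral_congr_ae (ae_of_all _ fun w => ?_)
  simp only
  ring

/-- Radial averages increase when coordinates are rescaled in a direction along which the
second derivative is nonnegative. -/
theorem integral_radial_le_integral_scaled {n : ℕ} {F : (Fin n → ℝ) → ℝ} (hF : ContDiff ℝ 2 F)
    {d : Fin n → ℝ} (hd : ∀ i, 0 < d i)
    (hF2 : ∀ y, 0 ≤ ∑ i, (d i - 1) *
      fderiv ℝ (fun z => fderiv ℝ F z (Pi.single i 1)) y (Pi.single i 1))
    {ψ : ℝ → ℝ} (hψ : Continuous ψ) (hψ0 : ∀ r, 0 ≤ ψ r) {M : ℝ} (hM : ∀ r, M ≤ r → ψ r = 0) :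
    ∫ w, ψ (w ⬝ᵥ w) * F w ≤ ∫ w, ψ (w ⬝ᵥ w) * F ((fun i => Real.sqrt (d i)) * w) := by
  have hF1 : ContDiff ℝ 1 F := hF.of_le (by norm_num)
  have hQ : Continuous fun w : Fin n → ℝ => w ⬝ᵥ w := by fun_prop
  have hGi : ∀ i, ContDiff ℝ 1 fun z => fderiv ℝ F z (Pi.single i 1) := fun i =>
    (hF.fderiv_right (m := 1) (by norm_num)).clm_apply contDiff_const
  set J : (Fin n → ℝ) → ℝ := fun s => ∫ w, ψ (w ⬝ᵥ w) * F (s * w) with hJ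
  -- The squares `σᵢ²` interpolate linearly from `1` to `dᵢ`, so `σᵢ' σᵢ = (dᵢ - 1)/2` does not
  -- depend on `t`.
  set σ : ℝ → Fin n → ℝ := fun t i => Real.sqrt (1 + t * (d i - 1)) with hσ
  have hpos : ∀ t ∈ Icc (0 : ℝ) 1, ∀ i, 0 < 1 + t * (d i - 1) := fun t ht i => by
    rcases eq_or_lt_of_le ht.2 with h | h
    · rw [h]; linarith [hd i]
    · nlinarith [ht.1, hd i, mul_nonneg ht.1 (hd i).le]
  have hP0 : ∀ u, 0 ≤ (∫ r in u..M, ψ r) / 2 := fun u => by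
    refine div_nonneg ?_ zero_le_two
    rcases le_total u M with h | h
    · exact intervalIntegral.integral_nonneg h fun r _ => hψ0 r
    · exact (integral_tail_eq_zero hM h).ge
  have hder : ∀ t ∈ Icc (0 : ℝ) 1, ∃ D, 0 ≤ D ∧ HasDerivAt (fun t => J (σ t)) D t := by
    intro t ht
    set σ' : Fin n → ℝ := fun i => (d i - 1) / (2 * Real.sqrt (1 + t * (d i - 1))) with hσ'
    have h1 : HasDerivAt σ σ' t := by
      rw [hasDerivAt_pi]
      intro i
      have : HasDerivAt (fun t : ℝ => 1 + t * (d i - 1)) (d i - 1) t := by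
        simpa using ((hasDerivAt_id t).mul_const (d i - 1)).const_add 1
      exact this.sqrt (hpos t ht i).ne'
    have h2 := (hasFDerivAt_integral_mul_dotProduct hF1 hψ hM (σ t)).comp_hasDerivAt t h1
    refine ⟨_, ?_, h2⟩
    have hcontF : Continuous fun w : Fin n → ℝ =>
        ψ (w ⬝ᵥ w) • (fderiv ℝ F (σ t * w)).comp (mulRightCLM w) := by
      refine (hψ.comp hQ).smul ?_
      exact ((hF1.continuous_fderiv one_ne_zero).comp (by fun_prop)).clm_comp
        continuous_mulRightCLM
    rw [ContinuousLinearMap.integral_apply (integrable_of_dotProduct_self (M := M) hcontF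
      fun w hw => by simp [hM _ hw])]
    have h3 : ∀ w : Fin n → ℝ,
        (ψ (w ⬝ᵥ w) • (fderiv ℝ F (σ t * w)).comp (mulRightCLM w)) σ' =
          ∑ i, σ' i * (ψ (w ⬝ᵥ w) * (w i * fderiv ℝ F (σ t * w) (Pi.single i 1))) := fun w => by
      have : σ' * w = ∑ i, (σ' i * w i) • (Pi.single i (1 : ℝ) : Fin n → ℝ) := by
        ext j
        simp [Finset.sum_apply, Pi.single_apply]
      rw [_root_.smul_apply, ContinuousLinearMap.comp_apply, mulRightCLM_apply, this,
        map_sum, smul_eq_mul, Finset.mul_sum]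
      refine Finset.sum_congr rfl fun i _ => ?_
      rw [map_smul, smul_eq_mul]
      ring
    simp only [h3]
    have hcG : ∀ i, Continuous fun w : Fin n → ℝ =>
        fderiv ℝ F (σ t * w) (Pi.single i 1) := fun i =>
      (hGi i).continuous.comp (by fun_prop : Continuous fun w : Fin n → ℝ => σ t * w)
    have hcG' : ∀ i, Continuous fun w : Fin n → ℝ =>
        fderiv ℝ (fun z => fderiv ℝ F z (Pi.single i 1)) (σ t * w) (Pi.single i 1) := fun i =>
      (((hGi i).continuous_fderiv one_ne_zero).comp
        (by fun_prop : Continuous fun w : Fin n → ℝ => σ t * w)).clm_apply continuous_const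
    have hPc := continuous_half_integral_tail hψ M
    have hP0' : ∀ u, M ≤ u → (∫ r in u..M, ψ r) = 0 := fun u hu => integral_tail_eq_zero hM hu
    rw [integral_finsetSum]
    · simp only [integral_const_mul]
      -- Each `wᵢ ∂ᵢF` becomes `σᵢ ∂ᵢᵢF` against the nonnegative potential.
      simp only [integral_radial_by_parts (hGi _) hψ hM]
      simp only [← integral_const_mul]
      rw [← integral_finsetSum]
      · refine integral_nonneg fun w => ?_
        have : ∑ i, σ' i * (σ t i * fderiv ℝ (fun z => fderiv ℝ F z (Pi.single i 1)) (σ t * w)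
            (Pi.single i 1) * ((∫ r in (w ⬝ᵥ w)..M, ψ r) / 2)) =
            (∑ i, (d i - 1) * fderiv ℝ (fun z => fderiv ℝ F z (Pi.single i 1)) (σ t * w)
              (Pi.single i 1)) * ((∫ r in (w ⬝ᵥ w)..M, ψ r) / 2) / 2 := by
          rw [Finset.sum_mul, Finset.sum_div]
          refine Finset.sum_congr rfl fun i _ => ?_
          have hne : Real.sqrt (1 + t * (d i - 1)) ≠ 0 := (Real.sqrt_pos.2 (hpos t ht i)).ne'
          have e : σ' i * σ t i = (d i - 1) / 2 := by
            simp only [hσ', hσ]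
            generalize Real.sqrt (1 + t * (d i - 1)) = r at hne
            field_simp
          rw [← mul_assoc, ← mul_assoc, e]
          ring
        simp only [Pi.zero_apply]
        rw [this]
        exact div_nonneg (mul_nonneg (hF2 _) (hP0 _)) zero_le_two
      · intro i _
        exact integrable_of_dotProduct_self (M := M)
          (continuous_const.mul ((continuous_const.mul (hcG' i)).mul (hPc.comp hQ)))
          fun w hw => by simp [hP0' _ hw]
    · intro i _
      exact integrable_of_dotProduct_self (M := M)
        (continuous_const.mul ((hψ.comp hQ).mul ((continuous_apply i).mul (hcG i))))
        fun w hw => by simp [hM _ hw]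
  have hmono : MonotoneOn (fun t => J (σ t)) (Icc 0 1) := by
    refine monotoneOn_of_deriv_nonneg (convex_Icc 0 1) ?_ ?_ ?_
    · intro t ht
      obtain ⟨D, -, hD⟩ := hder t ht
      exact hD.continuousAt.continuousWithinAt
    · intro t ht
      obtain ⟨D, -, hD⟩ := hder t (interior_subset ht)
      exact hD.differentiableAt.differentiableWithinAt
    · intro t ht
      obtain ⟨D, hD0, hD⟩ := hder t (interior_subset ht)
      rwa [hD.deriv]
  have h := hmono (left_mem_Icc.2 zero_le_one) (right_mem_Icc.2 zero_le_one) zero_le_one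
  have h0 : σ 0 = 1 := by ext i; simp [hσ]
  have h1 : σ 1 = fun i => Real.sqrt (d i) := by ext i; simp [hσ]
  simp only [h0, h1, hJ, one_mul] at h
  exact h

/-! ### From continuous weights to measurable generators -/

/-- Finite measures are compared by their integrals of nonnegative bounded continuous functions. -/
theorem measure_le_of_forall_lintegral_le {X : Type*} [PseudoMetricSpace X] [MeasurableSpace X]
    [BorelSpace X] {μ ν : Measure X} [IsFiniteMeasure μ] [IsFiniteMeasure ν]
    (h : ∀ ψ : X →ᵇ ℝ≥0, ∫⁻ x, ψ x ∂μ ≤ ∫⁻ x, ψ x ∂ν) : μ ≤ ν := by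
  rw [Measure.le_iff]
  intro s hs
  -- Inner regularity reduces to closed sets, whose indicators are limits of bounded continuous
  -- thickened indicators.
  rw [hs.measure_eq_iSup_isClosed_of_ne_top (measure_ne_top μ s)]
  refine iSup_le fun K => iSup_le fun hK => iSup_le fun hKc => le_trans ?_ (measure_mono hK)
  have hpos : ∀ n : ℕ, (0 : ℝ) < 1 / ((n : ℝ) + 1) := fun n => Nat.one_div_pos_of_nat
  have hlim := tendsto_one_div_add_atTop_nhds_zero_nat (𝕜 := ℝ)
  exact le_of_tendsto_of_tendsto'
    (tendsto_lintegral_thickenedIndicator_of_isClosed μ hKc hpos hlim)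
    (tendsto_lintegral_thickenedIndicator_of_isClosed ν hKc hpos hlim)
    fun n => h (thickenedIndicator (hpos n) K)

/-- Splits the sign of an integral into a comparison of two nonnegative integrals, which can be read
as a comparison of measures. -/
theorem integral_nonneg_iff_lintegral_neg_le {X : Type*} [MeasurableSpace X] {μ : Measure X}
    {f : X → ℝ} (hf : Integrable f μ) :
    0 ≤ ∫ x, f x ∂μ ↔ ∫⁻ x, ENNReal.ofReal (-f x) ∂μ ≤ ∫⁻ x, ENNReal.ofReal (f x) ∂μ := by
  have h : ∫⁻ x, ENNReal.ofReal (-f x) ∂μ ≠ ⊤ := hf.neg.lintegral_lt_top.ne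
  rw [integral_eq_lintegral_pos_part_sub_lintegral_neg_part hf, sub_nonneg,
    ENNReal.toReal_le_toReal h hf.lintegral_lt_top.ne]

/-- Positivity against continuous radial weights extends to measurable radial weights. -/
theorem setIntegral_radial_nonneg {n : ℕ} {k : (Fin n → ℝ) → ℝ} (hk : Continuous k)
    (h : ∀ (ψ : ℝ → ℝ) (M : ℝ), Continuous ψ → (∀ r, 0 ≤ ψ r) → (∀ r, M ≤ r → ψ r = 0) →
      0 ≤ ∫ w, ψ (w ⬝ᵥ w) * k w)
    {G : ℝ → ℝ} (hG : Measurable G) (hG0 : ∀ r, 0 ≤ r → 0 ≤ G r) {M : ℝ}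
    (hGi : IntegrableOn (fun w : Fin n → ℝ => G (w ⬝ᵥ w)) {w | w ⬝ᵥ w ≤ M}) :
    0 ≤ ∫ w in {w : Fin n → ℝ | w ⬝ᵥ w ≤ M}, G (w ⬝ᵥ w) * k w := by
  have hQ : Continuous fun w : Fin n → ℝ => w ⬝ᵥ w := by fun_prop
  have hQ0 : ∀ w : Fin n → ℝ, 0 ≤ w ⬝ᵥ w := fun w =>
    Finset.sum_nonneg fun i _ => mul_self_nonneg (w i)
  have hKc := isCompact_dotProduct_self_le n M
  set K := {w : Fin n → ℝ | w ⬝ᵥ w ≤ M} with hK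
  have hKm : MeasurableSet K := hKc.measurableSet
  -- A continuous cutoff, equal to 1 up to `M` and 0 from `M + 1` on: it makes the measures below
  -- finite and can be absorbed into a continuous weight.
  set χ : ℝ → ℝ := fun r => max 0 (min 1 (M + 1 - r)) with hχ
  have hχc : Continuous χ := by fun_prop
  have hχ0 : ∀ r, 0 ≤ χ r := fun r => le_max_left _ _
  have hχ1 : ∀ r, r ≤ M → χ r = 1 := fun r hr => by
    simp only [hχ]
    rw [min_eq_left (by linarith), max_eq_right zero_le_one]
  have hχM : ∀ r, M + 1 ≤ r → χ r = 0 := fun r hr => by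
    simp only [hχ]
    exact max_eq_left ((min_le_right _ _).trans (by linarith))
  -- As `ENNReal.ofReal` discards negative values, `ν k` and `ν (-k)` are the images under `w·w` of
  -- the cut-off positive and negative parts of `k`. The hypothesis says `ν (-k) ≤ ν k` when tested
  -- on continuous functions; once this holds for measures, `G` may be integrated.
  set ν : ((Fin n → ℝ) → ℝ) → Measure ℝ := fun l =>
    (volume.withDensity fun w => ENNReal.ofReal (χ (w ⬝ᵥ w) * l w)).map fun w => w ⬝ᵥ w with hν
  have hνl : ∀ l : (Fin n → ℝ) → ℝ, Continuous l → ∀ φ : ℝ → ℝ≥0∞, Measurable φ →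
      ∫⁻ r, φ r ∂(ν l) = ∫⁻ w, ENNReal.ofReal (χ (w ⬝ᵥ w) * l w) * φ (w ⬝ᵥ w) := by
    intro l hl φ hφ
    have hm : Measurable fun w : Fin n → ℝ => ENNReal.ofReal (χ (w ⬝ᵥ w) * l w) :=
      ((hχc.comp hQ).mul hl).measurable.ennreal_ofReal
    rw [hν, lintegral_map hφ hQ.measurable]
    exact lintegral_withDensity_eq_lintegral_mul _ hm (hφ.comp hQ.measurable)
  have hνf : ∀ l : (Fin n → ℝ) → ℝ, Continuous l → IsFiniteMeasure (ν l) := by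
    intro l hl
    have : IsFiniteMeasure
        (volume.withDensity fun w => ENNReal.ofReal (χ (w ⬝ᵥ w) * l w)) :=
      isFiniteMeasure_withDensity_ofReal (integrable_of_dotProduct_self (M := M + 1)
        ((hχc.comp hQ).mul hl) fun w hw => by simp [hχM _ hw]).2
    rw [hν]
    infer_instance
  have hk' : Continuous fun w => -k w := hk.neg
  have hle : ν (fun w => -k w) ≤ ν k := by
    have := hνf k hk
    have := hνf _ hk'
    refine measure_le_of_forall_lintegral_le fun ψ => ?_
    have hψm : Measurable fun r => (ψ r : ℝ≥0∞) := by fun_prop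
    rw [hνl _ hk' _ hψm, hνl _ hk _ hψm]
    have hψc : Continuous fun r => (ψ r : ℝ) := by fun_prop
    have h0 := h (fun r => ψ r * χ r) (M + 1) (hψc.mul hχc)
      (fun r => mul_nonneg (ψ r).2 (hχ0 r)) fun r hr => by simp [hχM r hr]
    have hi : Integrable fun w => ψ (w ⬝ᵥ w) * χ (w ⬝ᵥ w) * k w :=
      integrable_of_dotProduct_self (M := M + 1)
        (((hψc.mul hχc).comp hQ).mul hk) fun w hw => by simp [hχM _ hw]
    rw [integral_nonneg_iff_lintegral_neg_le hi] at h0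
    convert h0 using 3 with w w
    · rw [← ENNReal.ofReal_coe_nnreal, ← ENNReal.ofReal_mul' (NNReal.coe_nonneg _)]
      congr 1
      ring
    · rw [← ENNReal.ofReal_coe_nnreal, ← ENNReal.ofReal_mul' (NNReal.coe_nonneg _)]
      congr 1
      ring
  have hφm : Measurable fun r => ENNReal.ofReal ((Iic M).indicator G r) :=
    (hG.indicator measurableSet_Iic).ennreal_ofReal
  have h1 := lintegral_mono' hle (le_refl fun r => ENNReal.ofReal ((Iic M).indicator G r))
  rw [hνl _ hk' _ hφm, hνl _ hk _ hφm] at h1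
  have hset : ∀ l : (Fin n → ℝ) → ℝ,
      ∫⁻ w, ENNReal.ofReal (χ (w ⬝ᵥ w) * l w) *
        ENNReal.ofReal ((Iic M).indicator G (w ⬝ᵥ w)) =
      ∫⁻ w in K, ENNReal.ofReal (G (w ⬝ᵥ w) * l w) := by
    intro l
    rw [← lintegral_indicator hKm]
    refine lintegral_congr fun w => ?_
    by_cases hw : w ⬝ᵥ w ≤ M
    · rw [indicator_of_mem (show w ⬝ᵥ w ∈ Iic M from hw), indicator_of_mem (show w ∈ K from hw),
        hχ1 _ hw, one_mul, mul_comm, ← ENNReal.ofReal_mul (hG0 _ (hQ0 w))]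
    · rw [indicator_of_notMem (show w ⬝ᵥ w ∉ Iic M from hw),
        indicator_of_notMem (show w ∉ K from hw)]
      simp
  rw [hset, hset] at h1
  rw [integral_nonneg_iff_lintegral_neg_le]
  · simpa only [mul_neg] using h1
  · exact IntegrableOn.mul_continuousOn hGi hk.continuousOn hKc

theorem normalizingConst_nonneg {n : ℕ} {g : ℝ → ℝ} (hg : IsDensityGenerator n g) :
    0 ≤ normalizingConst n g :=
  mul_nonneg (div_nonneg (Real.Gamma_nonneg_of_nonneg (by positivity)) (by positivity))
    (inv_nonneg.2 hg.integral_pos.le)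

/-- Truncated expectations under a spherical distribution increase when coordinates are rescaled
in a direction along which the second derivative is nonnegative. -/
theorem setIntegral_spherical_le_scaled {n : ℕ} {g : ℝ → ℝ} (hg : IsDensityGenerator n g)
    [IsFiniteMeasure (ellipticalMeasure 0 (1 : Matrix (Fin n) (Fin n) ℝ) g)]
    {F : (Fin n → ℝ) → ℝ} (hF : ContDiff ℝ 2 F) {d : Fin n → ℝ} (hd : ∀ i, 0 < d i)
    (hF2 : ∀ y, 0 ≤ ∑ i, (d i - 1) *
      fderiv ℝ (fun z => fderiv ℝ F z (Pi.single i 1)) y (Pi.single i 1)) (M : ℝ) :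
    ∫ w in {w | w ⬝ᵥ w ≤ M}, F w ∂(ellipticalMeasure 0 1 g) ≤
      ∫ w in {w | w ⬝ᵥ w ≤ M}, F ((fun i => Real.sqrt (d i)) * w)
        ∂(ellipticalMeasure 0 1 g) := by
  have hQ : Continuous fun w : Fin n → ℝ => w ⬝ᵥ w := by fun_prop
  have hQ0 : ∀ w : Fin n → ℝ, 0 ≤ w ⬝ᵥ w := fun w =>
    Finset.sum_nonneg fun i _ => mul_self_nonneg (w i)
  have hc := normalizingConst_nonneg hg
  have hFc : Continuous F := hF.continuous
  have hFs : Continuous fun w : Fin n → ℝ => F ((fun i => Real.sqrt (d i)) * w) :=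
    hFc.comp (by fun_prop)
  have hKc := isCompact_dotProduct_self_le n M
  have hGm : Measurable fun w : Fin n → ℝ => normalizingConst n g * g (w ⬝ᵥ w) :=
    (hg.measurable.comp hQ.measurable).const_mul _
  have hG0 : ∀ w : Fin n → ℝ, 0 ≤ normalizingConst n g * g (w ⬝ᵥ w) := fun w =>
    mul_nonneg hc (hg.nonneg _ (hQ0 w))
  -- The density is integrable because the spherical measure is finite.
  have hGi : Integrable fun w : Fin n → ℝ => normalizingConst n g * g (w ⬝ᵥ w) := by
    refine ⟨hGm.aestronglyMeasurable, ?_⟩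
    rw [hasFiniteIntegral_iff_ofReal (ae_of_all _ hG0)]
    have := measure_lt_top (ellipticalMeasure 0 (1 : Matrix (Fin n) (Fin n) ℝ) g) univ
    rwa [ellipticalMeasure_zero_one, withDensity_apply _ MeasurableSet.univ,
      Measure.restrict_univ] at this
  have hint : ∀ l : (Fin n → ℝ) → ℝ,
      ∫ w in {w | w ⬝ᵥ w ≤ M}, l w ∂(ellipticalMeasure 0 1 g) =
        ∫ w in {w : Fin n → ℝ | w ⬝ᵥ w ≤ M}, (normalizingConst n g * g (w ⬝ᵥ w)) * l w := by
    intro l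
    rw [ellipticalMeasure_zero_one,
      setIntegral_withDensity_eq_setIntegral_toReal_smul hGm.ennreal_ofReal
        (ae_of_all _ fun w => ENNReal.ofReal_lt_top) _ hKc.measurableSet]
    refine integral_congr_ae (ae_of_all _ fun w => ?_)
    simp only [ENNReal.toReal_ofReal (hG0 w), smul_eq_mul]
  have hk := setIntegral_radial_nonneg (k := fun w => F ((fun i => Real.sqrt (d i)) * w) - F w)
    (hFs.sub hFc) (fun ψ M hψ hψ0 hM => by
      have := integral_radial_le_integral_scaled hF hd hF2 hψ hψ0 hM
      simp only [mul_sub]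
      rw [integral_sub]
      · linarith
      · exact integrable_of_dotProduct_self ((hψ.comp hQ).mul hFs)
          (M := M) fun w hw => by simp [hM _ hw]
      · exact integrable_of_dotProduct_self ((hψ.comp hQ).mul hFc)
          (M := M) fun w hw => by simp [hM _ hw])
    (G := fun r => normalizingConst n g * g r) (hg.measurable.const_mul _)
    (fun r hr => mul_nonneg hc (hg.nonneg r hr)) (M := M) hGi.integrableOn
  simp only [mul_sub] at hk
  rw [integral_sub (hGi.integrableOn.mul_continuousOn hFs.continuousOn hKc)
    (hGi.integrableOn.mul_continuousOn hFc.continuousOn hKc)] at hk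
  rw [hint, hint]
  linarith

/-! ### Second derivatives and the trace pairing -/

/-- Partial derivatives of a function composed with an affine map. -/
theorem fderiv_comp_affine_single {m n : ℕ} {G : (Fin n → ℝ) → ℝ} (hG : Differentiable ℝ G)
    (c : Fin n → ℝ) (A : Matrix (Fin n) (Fin m) ℝ) (y : Fin m → ℝ) (i : Fin m) :
    fderiv ℝ (fun z => G (c + A *ᵥ z)) y (Pi.single i 1) =
      ∑ j, A j i * fderiv ℝ G (c + A *ᵥ y) (Pi.single j 1) := by
  set L : (Fin m → ℝ) →L[ℝ] (Fin n → ℝ) := A.mulVecLin.toContinuousLinearMap with hL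
  have h1 : HasFDerivAt (fun z : Fin m → ℝ => c + A *ᵥ z) L y := L.hasFDerivAt.const_add c
  have h2 := HasFDerivAt.comp (g := G) y (hG (c + A *ᵥ y)).hasFDerivAt h1
  have h3 : fderiv ℝ (fun z => G (c + A *ᵥ z)) y = (fderiv ℝ G (c + A *ᵥ y)).comp L := h2.fderiv
  have h4 : L (Pi.single i 1) = ∑ j, A j i • (Pi.single j (1 : ℝ) : Fin n → ℝ) := by
    ext k
    simp [hL, Finset.sum_apply, Pi.single_apply]
  rw [h3, ContinuousLinearMap.comp_apply, h4, map_sum]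
  simp

/-- Second partial derivatives of a function composed with an affine map. -/
theorem fderiv_fderiv_comp_affine_single {m n : ℕ} {f : (Fin n → ℝ) → ℝ} (hf : ContDiff ℝ 2 f)
    (c : Fin n → ℝ) (A : Matrix (Fin n) (Fin m) ℝ) (y : Fin m → ℝ) (i : Fin m) :
    fderiv ℝ (fun z => fderiv ℝ (fun z => f (c + A *ᵥ z)) z (Pi.single i 1)) y (Pi.single i 1) =
      (Aᵀ * hessian f (c + A *ᵥ y) * A) i i := by
  have hd : ∀ j : Fin n, Differentiable ℝ fun z => fderiv ℝ f z (Pi.single j 1) := fun j =>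
    ((hf.fderiv_right (m := 1) (by norm_num)).clm_apply contDiff_const).differentiable one_ne_zero
  have haff : Differentiable ℝ fun z : Fin m → ℝ => c + A *ᵥ z :=
    A.mulVecLin.toContinuousLinearMap.differentiable.const_add c
  simp only [fderiv_comp_affine_single (hf.differentiable two_ne_zero)]
  have hdc : ∀ j : Fin n, DifferentiableAt ℝ
      (fun z => fderiv ℝ f (c + A *ᵥ z) (Pi.single j 1)) y := fun j => ((hd j).comp haff) y
  rw [fderiv_fun_sum fun j _ => (hdc j).const_mul _]
  simp only [_root_.sum_apply]
  rw [Matrix.mul_apply]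
  refine Finset.sum_congr rfl fun j _ => ?_
  rw [fderiv_const_mul (hdc j), _root_.smul_apply,
    fderiv_comp_affine_single (hd j), Matrix.mul_apply, smul_eq_mul, mul_comm]
  simp [hessian]

/-- With `h = CᵀC`, the trace equals that of `C X Cᵀ`, whose diagonal entries are the quadratic form
of `X` at the nonnegative rows of `C`. -/
theorem trace_mul_nonneg_of_copositive {n : ℕ} {X h : Matrix (Fin n) (Fin n) ℝ}
    (hX : Copositive X) (hh : CompletelyPositive h) : 0 ≤ (X * h).trace := by
  obtain ⟨m, C, hC, rfl⟩ := hh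
  rw [← Matrix.mul_assoc, Matrix.trace_mul_comm, ← Matrix.mul_assoc]
  refine Finset.sum_nonneg fun l _ => ?_
  have := hX (C l) (hC l)
  rwa [Matrix.dotProduct_mulVec] at this

/-- By the chain rule and cyclicity of the trace, the sum is `a²` times the trace pairing of the
copositive matrix with the Hessian of `f`. -/
theorem sum_second_derivatives_nonneg {n : ℕ} {B : Matrix (Fin n) (Fin n) ℝ} {d : Fin n → ℝ}
    (hX : Copositive (B * diagonal d * Bᵀ - B * Bᵀ)) {f : (Fin n → ℝ) → ℝ} (hf : ContDiff ℝ 2 f)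
    (hh : ∀ x, CompletelyPositive (hessian f x)) (c : Fin n → ℝ) (a : ℝ) (y : Fin n → ℝ) :
    0 ≤ ∑ i, (d i - 1) * fderiv ℝ
      (fun z => fderiv ℝ (fun z => f (c + (a • B) *ᵥ z)) z (Pi.single i 1)) y (Pi.single i 1) := by
  simp only [fderiv_fderiv_comp_affine_single hf]
  set h := hessian f (c + (a • B) *ᵥ y)
  have e : ∑ i, (d i - 1) * ((a • B)ᵀ * h * (a • B)) i i =
      a ^ 2 * ((B * diagonal d * Bᵀ - B * Bᵀ) * h).trace := by
    have : ∑ i, (d i - 1) * ((a • B)ᵀ * h * (a • B)) i i =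
        (diagonal (fun i => d i - 1) * ((a • B)ᵀ * h * (a • B))).trace := by
      simp only [Matrix.trace, Matrix.diag_apply, Matrix.diagonal_mul]
    have hdiag : diagonal (fun i => d i - 1) = diagonal d - (1 : Matrix (Fin n) (Fin n) ℝ) := by
      rw [← diagonal_one, ← diagonal_sub]
    have hB : B * diagonal d * Bᵀ - B * Bᵀ = B * (diagonal d - 1) * Bᵀ := by
      rw [Matrix.mul_sub, Matrix.sub_mul, Matrix.mul_one]
    rw [this, hdiag, hB]
    simp only [Matrix.transpose_smul, Matrix.smul_mul, Matrix.mul_smul, smul_smul,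
      Matrix.trace_smul, smul_eq_mul, sq]
    congr 1
    rw [← Matrix.mul_assoc, Matrix.trace_mul_comm]
    simp only [Matrix.mul_assoc]
  rw [e]
  exact mul_nonneg (sq_nonneg a) (trace_mul_nonneg_of_copositive hX (hh _))

/-! ### Truncation of extended expectations and sufficiency -/

theorem tendsto_setLIntegral_of_monotone {X : Type*} [MeasurableSpace X] (μ : Measure X)
    {K : ℕ → Set X} (hK : Monotone K) (hU : ⋃ N, K N = univ) (f : X → ℝ≥0∞) :
    Tendsto (fun N => ∫⁻ x in K N, f x ∂μ) atTop (𝓝 (∫⁻ x, f x ∂μ)) := by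
  have h := setLIntegral_iUnion_of_directed (μ := μ) f (directed_of_isDirected_le hK)
  rw [hU, Measure.restrict_univ] at h
  rw [h]
  exact tendsto_atTop_iSup fun i j hij => lintegral_mono_set (hK hij)

/-- Well defined expectations are limits of truncated expectations. -/
theorem tendsto_expectation_restrict {Ω : Type*} [MeasurableSpace Ω] {X : Ω → ℝ} {P : Measure Ω}
    (hX : HasExpectation X P) {K : ℕ → Set Ω} (hK : Monotone K) (hU : ⋃ N, K N = univ) :
    Tendsto (fun N => expectation X (P.restrict (K N))) atTop (𝓝 (expectation X P)) := by
  have h1 := tendsto_setLIntegral_of_monotone P hK hU fun ω => ENNReal.ofReal (X ω)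
  have h2 := tendsto_setLIntegral_of_monotone P hK hU fun ω => ENNReal.ofReal (-X ω)
  have h1' := (continuous_coe_ennreal_ereal.tendsto _).comp h1
  have h2' := ((continuous_neg (G := EReal)).tendsto _).comp
    ((continuous_coe_ennreal_ereal.tendsto _).comp h2)
  simp only [expectation, sub_eq_add_neg]
  -- Addition on `EReal` is discontinuous only at `(⊤, ⊥)` and `(⊥, ⊤)`. Well-definedness excludes
  -- the first; the second cannot occur because `E[X⁺]` is never `⊥`.
  refine (EReal.continuousAt_add (p := (_, _)) ?_ ?_).tendsto.comp (h1'.prodMk_nhds h2')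
  · rcases hX.2 with h | h
    · left; simpa using h
    · right; simpa using h
  · left; simp

/-- Moves both expectations to the common space of pairs `(w, z)`, where the same truncation applies
to both. -/
theorem expectation_comp_of_hasLaw {Ω X Z : Type*} [MeasurableSpace Ω] [MeasurableSpace X]
    [MeasurableSpace Z] {P : Measure Ω} {ρ : Measure Z} {T : Z → X} (hT : Measurable T)
    {Y : Ω → X} (hY : HasLaw Y (ρ.map T) P) {f : X → ℝ} (hf : Measurable f) :
    expectation (fun ω => f (Y ω)) P = expectation (fun z => f (T z)) ρ ∧
      (HasExpectation (fun ω => f (Y ω)) P → HasExpectation (fun z => f (T z)) ρ) := by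
  have h1 : ∫⁻ ω, ENNReal.ofReal (f (Y ω)) ∂P = ∫⁻ z, ENNReal.ofReal (f (T z)) ∂ρ := by
    rw [hY.lintegral_comp (f := fun x => ENNReal.ofReal (f x)) hf.ennreal_ofReal.aemeasurable,
      lintegral_map hf.ennreal_ofReal hT]
  have hfn : Measurable fun x => ENNReal.ofReal (-f x) := hf.neg.ennreal_ofReal
  have h2 : ∫⁻ ω, ENNReal.ofReal (-f (Y ω)) ∂P = ∫⁻ z, ENNReal.ofReal (-f (T z)) ∂ρ := by
    rw [hY.lintegral_comp (f := fun x => ENNReal.ofReal (-f x)) hfn.aemeasurable,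
      lintegral_map hfn hT]
  refine ⟨by rw [expectation, expectation, h1, h2], fun h => ⟨(hf.comp hT).aemeasurable, ?_⟩⟩
  rw [← h1, ← h2]
  exact h.2

theorem integrable_restrict_of_bounded_image {Z : Type*} [MeasurableSpace Z] {n : ℕ}
    {ρ : Measure Z} [IsFiniteMeasure ρ] {T : Z → Fin n → ℝ} (hT : Measurable T)
    {f : (Fin n → ℝ) → ℝ} (hf : Continuous f) {K : Set Z} (hK : MeasurableSet K) {C : ℝ}
    (hC : ∀ z ∈ K, ‖T z‖ ≤ C) : Integrable (fun z => f (T z)) (ρ.restrict K) := by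
  obtain ⟨D, hD⟩ := (isCompact_closedBall (0 : Fin n → ℝ) C).exists_bound_of_continuousOn
    hf.continuousOn
  refine Integrable.of_bound (hf.measurable.comp hT).aestronglyMeasurable D ?_
  refine (ae_restrict_iff' hK).2 (ae_of_all _ fun z hz => hD _ ?_)
  simpa using hC z hz

/-- Location-scale mixtures of a spherical distribution are ordered by their scale matrices. -/
theorem cpOrder_of_copositive {n q : ℕ} {g : ℝ → ℝ} (hg : IsDensityGenerator n g)
    [IsFiniteMeasure (ellipticalMeasure 0 (1 : Matrix (Fin n) (Fin n) ℝ) g)]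
    {Ω₁ Ω₂ : Type*} [MeasurableSpace Ω₁] [MeasurableSpace Ω₂] {P₁ : Measure Ω₁} {P₂ : Measure Ω₂}
    {Y₁ : Ω₁ → Fin n → ℝ} {Y₂ : Ω₂ → Fin n → ℝ} (μ δ : Fin n → ℝ)
    {B : Matrix (Fin n) (Fin n) ℝ} {d : Fin n → ℝ} (hd : ∀ i, 0 < d i)
    (hX : Copositive (B * diagonal d * Bᵀ - B * Bᵀ))
    {α β : (Fin q → ℝ) → ℝ} (hα : Measurable α) (hβ : Measurable β)
    (hα0 : ∀ z, 0 ≤ α z) (hβ0 : ∀ z, 0 ≤ β z) (H : Measure (Fin q → ℝ)) [IsFiniteMeasure H]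
    (hY₁ : HasLaw Y₁ (((ellipticalMeasure 0 1 g).prod H).map
        fun p => μ + α p.2 • B *ᵥ p.1 + β p.2 • δ) P₁)
    (hY₂ : HasLaw Y₂ (((ellipticalMeasure 0 1 g).prod H).map
        fun p => μ + α p.2 • (B * diagonal fun i => Real.sqrt (d i)) *ᵥ p.1 + β p.2 • δ) P₂) :
    CPOrder Y₁ P₁ Y₂ P₂ := by
  intro f hf hh hE₁ hE₂
  set ν := ellipticalMeasure 0 (1 : Matrix (Fin n) (Fin n) ℝ) g
  set B₂ := B * diagonal fun i => Real.sqrt (d i) with hB₂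
  have hT : ∀ A : Matrix (Fin n) (Fin n) ℝ,
      Measurable fun p : (Fin n → ℝ) × (Fin q → ℝ) => μ + α p.2 • A *ᵥ p.1 + β p.2 • δ := fun A => by
    have := measurable_mulVec A
    fun_prop
  have hfm := hf.continuous.measurable
  obtain ⟨e₁, hE₁'⟩ := expectation_comp_of_hasLaw (hT B) hY₁ hfm
  obtain ⟨e₂, hE₂'⟩ := expectation_comp_of_hasLaw (hT B₂) hY₂ hfm
  rw [e₁, e₂]
  -- These sets are products, radial in `w`, and have bounded image under both mixing maps.
  set K : ℕ → Set ((Fin n → ℝ) × (Fin q → ℝ)) := fun N =>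
    {w | w ⬝ᵥ w ≤ (N : ℝ)} ×ˢ {z | α z ≤ N ∧ β z ≤ N} with hK
  have hKc := fun N : ℕ => isCompact_dotProduct_self_le n (N : ℝ)
  have hKz : ∀ N : ℕ, MeasurableSet {z | α z ≤ N ∧ β z ≤ N} := fun N =>
    (measurableSet_le hα measurable_const).inter (measurableSet_le hβ measurable_const)
  have hKm : ∀ N, MeasurableSet (K N) := fun N => (hKc N).measurableSet.prod (hKz N)
  have hmono : Monotone K := by
    intro N N' h p hp
    have h' : (N : ℝ) ≤ N' := by exact_mod_cast h
    exact ⟨le_trans hp.1 h', le_trans hp.2.1 h', le_trans hp.2.2 h'⟩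
  have hU : ⋃ N, K N = univ := by
    refine eq_univ_of_forall fun p => mem_iUnion.2 ?_
    obtain ⟨N, hN⟩ := exists_nat_ge (max (p.1 ⬝ᵥ p.1) (max (α p.2) (β p.2)))
    exact ⟨N, (le_max_left _ _).trans hN, ((le_max_left _ _).trans (le_max_right _ _)).trans hN,
      ((le_max_right _ _).trans (le_max_right _ _)).trans hN⟩
  refine le_of_tendsto_of_tendsto' (tendsto_expectation_restrict (hE₁' hE₁) hmono hU)
    (tendsto_expectation_restrict (hE₂' hE₂) hmono hU) fun N => ?_
  have hi : ∀ A : Matrix (Fin n) (Fin n) ℝ,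
      Integrable (fun p : (Fin n → ℝ) × (Fin q → ℝ) => f (μ + α p.2 • A *ᵥ p.1 + β p.2 • δ))
        ((ν.prod H).restrict (K N)) := by
    intro A
    obtain ⟨D, hD⟩ := (hKc N).exists_bound_of_continuousOn
      (f := fun w => A *ᵥ w) (by fun_prop)
    refine integrable_restrict_of_bounded_image (hT A) hf.continuous (hKm N)
      (C := ‖μ‖ + N * D + N * ‖δ‖) fun p hp => ?_
    refine (norm_add₃_le).trans ?_
    rw [norm_smul, norm_smul, Real.norm_of_nonneg (hα0 _), Real.norm_of_nonneg (hβ0 _)]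
    have h1 := mul_le_mul hp.2.1 (hD _ hp.1) (norm_nonneg _) (Nat.cast_nonneg N)
    have h2 := mul_le_mul_of_nonneg_right hp.2.2 (norm_nonneg δ)
    linarith
  rw [expectation_eq_integral (hi B), expectation_eq_integral (hi B₂), EReal.coe_le_coe_iff]
  have hr : (ν.prod H).restrict (K N) =
      (ν.restrict {w | w ⬝ᵥ w ≤ (N : ℝ)}).prod (H.restrict {z | α z ≤ N ∧ β z ≤ N}) :=
    (Measure.prod_restrict _ _).symm
  have hiB := hi B
  have hiB₂ := hi B₂
  rw [hr] at hiB hiB₂ ⊢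
  -- Integrating over `w` first, the inequality holds for each fixed `z`, where location and scale
  -- are constants.
  rw [integral_prod_symm _ hiB, integral_prod_symm _ hiB₂]
  refine integral_mono hiB.integral_prod_right hiB₂.integral_prod_right fun z => ?_
  have hF : ContDiff ℝ 2 fun w => f ((μ + β z • δ) + (α z • B) *ᵥ w) :=
    hf.comp (contDiff_const.add (α z • B).mulVecLin.toContinuousLinearMap.contDiff)
  have key := setIntegral_spherical_le_scaled hg hF hd
    (sum_second_derivatives_nonneg hX hf hh (μ + β z • δ) (α z)) N
  have e : ∀ A : Matrix (Fin n) (Fin n) ℝ, ∀ w,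
      μ + α z • A *ᵥ w + β z • δ = (μ + β z • δ) + (α z • A) *ᵥ w := fun A w => by
    rw [Matrix.smul_mulVec]; abel
  have e' : ∀ w : Fin n → ℝ, (α z • B) *ᵥ ((fun i => Real.sqrt (d i)) * w) =
      (α z • B₂) *ᵥ w := fun w => by
    rw [Matrix.smul_mulVec, Matrix.smul_mulVec, hB₂, ← Matrix.mulVec_mulVec]
    congr 2
    ext i
    simp [Matrix.mulVec_diagonal]
  simp only [e']  at key
  simp only [e]
  exact key

/-! ### Linear and quadratic test functions -/

theorem completelyPositive_zero (n : ℕ) :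
    CompletelyPositive (0 : Matrix (Fin n) (Fin n) ℝ) :=
  ⟨0, 0, fun i => i.elim0, by simp⟩

theorem hasFDerivAt_dotProduct {n : ℕ} (v y : Fin n → ℝ) :
    HasFDerivAt (fun y => v ⬝ᵥ y) (dotProductBilin ℝ ℝ v).toContinuousLinearMap y :=
  (dotProductBilin ℝ ℝ v).toContinuousLinearMap.hasFDerivAt

theorem contDiff_dotProduct {n : ℕ} (v : Fin n → ℝ) : ContDiff ℝ 2 fun y => v ⬝ᵥ y :=
  (dotProductBilin ℝ ℝ v).toContinuousLinearMap.contDiff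

theorem hessian_dotProduct {n : ℕ} (v x : Fin n → ℝ) : hessian (fun y => v ⬝ᵥ y) x = 0 := by
  ext i j
  simp [hessian, (hasFDerivAt_dotProduct v _).fderiv]

/-- The Hessian is `2 v vᵀ`, so the single row `√2 v` is a nonnegative factor. -/
theorem completelyPositive_hessian_dotProduct_sq {n : ℕ} {v : Fin n → ℝ} (hv : ∀ i, 0 ≤ v i)
    (x : Fin n → ℝ) : CompletelyPositive (hessian (fun y => (v ⬝ᵥ y) ^ 2) x) := by
  refine ⟨1, Matrix.of fun _ j => Real.sqrt 2 * v j, fun _ j => ?_, ?_⟩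
  · exact mul_nonneg (Real.sqrt_nonneg 2) (hv j)
  · ext i j
    have h1 : ∀ y, fderiv ℝ (fun y => (v ⬝ᵥ y) ^ 2) y (Pi.single j 1) = 2 * v j * (v ⬝ᵥ y) := by
      intro y
      rw [((hasFDerivAt_dotProduct v y).pow 2).fderiv]
      simp
      ring
    have h2 : fderiv ℝ (fun y => 2 * v j * (v ⬝ᵥ y)) x (Pi.single i 1) = 2 * v j * v i := by
      rw [((hasFDerivAt_dotProduct v x).const_mul (2 * v j)).fderiv]
      simp
    simp only [hessian, Matrix.of_apply, h1, h2, Matrix.mul_apply, Matrix.transpose_apply,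
      Finset.univ_unique, Finset.sum_singleton]
    have := Real.mul_self_sqrt (zero_le_two (α := ℝ))
    linear_combination (-(v i * v j)) * this

theorem CPOrder.integral_le {n : ℕ} {Ω₁ Ω₂ : Type*} [MeasurableSpace Ω₁] [MeasurableSpace Ω₂]
    {Y₁ : Ω₁ → Fin n → ℝ} {P₁ : Measure Ω₁} {Y₂ : Ω₂ → Fin n → ℝ} {P₂ : Measure Ω₂}
    (h : CPOrder Y₁ P₁ Y₂ P₂) {f : (Fin n → ℝ) → ℝ} (hf : ContDiff ℝ 2 f)
    (hh : ∀ x, CompletelyPositive (hessian f x)) (h₁ : Integrable (fun ω => f (Y₁ ω)) P₁)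
    (h₂ : Integrable (fun ω => f (Y₂ ω)) P₂) :
    ∫ ω, f (Y₁ ω) ∂P₁ ≤ ∫ ω, f (Y₂ ω) ∂P₂ := by
  have := h f hf hh (hasExpectation_of_integrable h₁) (hasExpectation_of_integrable h₂)
  rwa [expectation_eq_integral h₁, expectation_eq_integral h₂, EReal.coe_le_coe_iff] at this

theorem memLp_dotProduct {n : ℕ} {Z : Type*} [MeasurableSpace Z] {ρ : Measure Z}
    {T : Z → Fin n → ℝ} (hT : MemLp T 2 ρ) (v : Fin n → ℝ) : MemLp (fun z => v ⬝ᵥ T z) 2 ρ :=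
  (dotProductBilin ℝ ℝ v).toContinuousLinearMap.comp_memLp' hT

theorem memLp_of_hasLaw_map {n : ℕ} {Ω Z : Type*} [MeasurableSpace Ω] [MeasurableSpace Z]
    {P : Measure Ω} {ρ : Measure Z} {T : Z → Fin n → ℝ} (hT : Measurable T) {Y : Ω → Fin n → ℝ}
    (hY : HasLaw Y (ρ.map T) P) (h : MemLp Y 2 P) : MemLp T 2 ρ := by
  have h1 : MemLp id 2 (P.map Y) :=
    (memLp_map_measure_iff aestronglyMeasurable_id hY.aemeasurable).2 h
  rw [hY.map_eq] at h1
  exact (memLp_map_measure_iff aestronglyMeasurable_id hT.aemeasurable).1 h1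

theorem integral_comp_of_hasLaw_map {n : ℕ} {Ω Z : Type*} [MeasurableSpace Ω] [MeasurableSpace Z]
    {P : Measure Ω} {ρ : Measure Z} {T : Z → Fin n → ℝ} (hT : Measurable T) {Y : Ω → Fin n → ℝ}
    (hY : HasLaw Y (ρ.map T) P) {f : (Fin n → ℝ) → ℝ} (hf : Continuous f) :
    ∫ ω, f (Y ω) ∂P = ∫ z, f (T z) ∂ρ := by
  have := hY.integral_comp (f := f) hf.aestronglyMeasurable
  rw [integral_map hT.aemeasurable hf.aestronglyMeasurable] at this
  exact this

/-- Means of linear functionals agree under the order. -/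
theorem CPOrder.integral_dotProduct_eq {n : ℕ} {Ω₁ Ω₂ Z : Type*} [MeasurableSpace Ω₁]
    [MeasurableSpace Ω₂] [MeasurableSpace Z] {Y₁ : Ω₁ → Fin n → ℝ} {P₁ : Measure Ω₁}
    {Y₂ : Ω₂ → Fin n → ℝ} {P₂ : Measure Ω₂} {ρ : Measure Z} [IsFiniteMeasure ρ]
    [IsFiniteMeasure P₁] [IsFiniteMeasure P₂]
    {T₁ T₂ : Z → Fin n → ℝ} (hT₁ : Measurable T₁) (hT₂ : Measurable T₂)
    (hY₁ : HasLaw Y₁ (ρ.map T₁) P₁) (hY₂ : HasLaw Y₂ (ρ.map T₂) P₂)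
    (m₁ : MemLp Y₁ 2 P₁) (m₂ : MemLp Y₂ 2 P₂)
    (h : CPOrder Y₁ P₁ Y₂ P₂) (v : Fin n → ℝ) :
    ∫ z, v ⬝ᵥ T₁ z ∂ρ = ∫ z, v ⬝ᵥ T₂ z ∂ρ := by
  have key : ∀ v : Fin n → ℝ, ∫ z, v ⬝ᵥ T₁ z ∂ρ ≤ ∫ z, v ⬝ᵥ T₂ z ∂ρ := fun v => by
    have hc : Continuous fun y => v ⬝ᵥ y := (contDiff_dotProduct v).continuous
    have := h.integral_le (contDiff_dotProduct v)
      (fun x => by rw [hessian_dotProduct]; exact completelyPositive_zero n)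
      ((memLp_dotProduct m₁ v).integrable one_le_two)
      ((memLp_dotProduct m₂ v).integrable one_le_two)
    rwa [integral_comp_of_hasLaw_map hT₁ hY₁ hc, integral_comp_of_hasLaw_map hT₂ hY₂ hc] at this
  refine le_antisymm (key v) ?_
  -- The zero Hessian makes `-v` admissible as well, with no sign condition.
  have := key (-v)
  simp only [neg_dotProduct, integral_neg] at this
  linarith

/-- Second moments of nonnegative linear functionals increase under the order. -/
theorem CPOrder.integral_dotProduct_sq_le {n : ℕ} {Ω₁ Ω₂ Z : Type*} [MeasurableSpace Ω₁]
    [MeasurableSpace Ω₂] [MeasurableSpace Z] {Y₁ : Ω₁ → Fin n → ℝ} {P₁ : Measure Ω₁}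
    {Y₂ : Ω₂ → Fin n → ℝ} {P₂ : Measure Ω₂} {ρ : Measure Z}
    {T₁ T₂ : Z → Fin n → ℝ} (hT₁ : Measurable T₁) (hT₂ : Measurable T₂)
    (hY₁ : HasLaw Y₁ (ρ.map T₁) P₁) (hY₂ : HasLaw Y₂ (ρ.map T₂) P₂)
    (m₁ : MemLp Y₁ 2 P₁) (m₂ : MemLp Y₂ 2 P₂)
    (h : CPOrder Y₁ P₁ Y₂ P₂) {v : Fin n → ℝ} (hv : ∀ i, 0 ≤ v i) :
    ∫ z, (v ⬝ᵥ T₁ z) ^ 2 ∂ρ ≤ ∫ z, (v ⬝ᵥ T₂ z) ^ 2 ∂ρ := by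
  have hc : Continuous fun y => (v ⬝ᵥ y) ^ 2 := (contDiff_dotProduct v).continuous.pow 2
  have := h.integral_le ((contDiff_dotProduct v).pow 2)
    (completelyPositive_hessian_dotProduct_sq hv)
    (memLp_dotProduct m₁ v).integrable_sq (memLp_dotProduct m₂ v).integrable_sq
  rwa [integral_comp_of_hasLaw_map hT₁ hY₁ hc, integral_comp_of_hasLaw_map hT₂ hY₂ hc] at this

/-! ### Symmetries and second moments of the spherical law -/

section Spherical

variable {n q : ℕ} {g : ℝ → ℝ}

/-- Orthogonal invariance: `Q` carries the spherical law to the elliptical one with scale matrix `Q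
Qᵀ = 1`. -/
theorem map_mulVec_spherical (hg : Measurable g) {Q : Matrix (Fin n) (Fin n) ℝ}
    (hQ : Q * Qᵀ = 1) :
    (ellipticalMeasure 0 1 g).map Q.mulVec = ellipticalMeasure 0 1 g := by
  have hdet : Q.det ≠ 0 := fun h0 => by
    have := congrArg det hQ
    simp [h0] at this
  rw [← ellipticalMeasure_mul_transpose Q hdet hg, hQ]

theorem measurePreserving_neg_spherical (hg : Measurable g) :
    MeasurePreserving (fun w : Fin n → ℝ => -w) (ellipticalMeasure 0 1 g)
      (ellipticalMeasure 0 1 g) := by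
  refine ⟨measurable_neg, ?_⟩
  have := map_mulVec_spherical (n := n) hg (Q := -1) (by simp)
  convert this using 2
  ext1 w
  simp [Matrix.neg_mulVec]

/-- Reflecting the `i`-th coordinate preserves the law and negates the product. -/
theorem integral_coord_mul_coord (hg : Measurable g) {i j : Fin n} (hij : i ≠ j) :
    ∫ w, w i * w j ∂(ellipticalMeasure 0 (1 : Matrix (Fin n) (Fin n) ℝ) g) = 0 := by
  set s : Fin n → ℝ := Function.update 1 i (-1) with hs
  have hss : ∀ k, s k * s k = 1 := fun k => by
    by_cases h : k = i
    · subst h; simp [hs]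
    · simp [hs, Function.update_of_ne h]
  have h1 := map_mulVec_spherical (n := n) hg (Q := diagonal s) (by
    rw [diagonal_transpose, diagonal_mul_diagonal, ← diagonal_one]
    congr 1
    ext k
    exact hss k)
  have h2 : ∫ w, w i * w j ∂(ellipticalMeasure 0 (1 : Matrix (Fin n) (Fin n) ℝ) g) =
      ∫ w, -(w i * w j) ∂(ellipticalMeasure 0 (1 : Matrix (Fin n) (Fin n) ℝ) g) := by
    conv_lhs => rw [← h1]
    rw [integral_map (measurable_mulVec _).aemeasurable (by fun_prop)]
    refine integral_congr_ae (ae_of_all _ fun w => ?_)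
    simp [Matrix.mulVec_diagonal, hs, Function.update_of_ne hij.symm]
  rw [integral_neg] at h2
  linarith

/-- The permutation matrix swapping `i` and `j` is orthogonal. -/
theorem integral_coord_sq_eq (hg : Measurable g) (i j : Fin n) :
    ∫ w, w i * w i ∂(ellipticalMeasure 0 (1 : Matrix (Fin n) (Fin n) ℝ) g) =
      ∫ w, w j * w j ∂(ellipticalMeasure 0 (1 : Matrix (Fin n) (Fin n) ℝ) g) := by
  set Q : Matrix (Fin n) (Fin n) ℝ := (1 : Matrix (Fin n) (Fin n) ℝ).submatrix (Equiv.swap i j) id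
  have h1 := map_mulVec_spherical (n := n) hg (Q := Q) (by
    rw [Matrix.transpose_submatrix, Matrix.transpose_one, ← Matrix.submatrix_mul _ _ _ _ _
      Function.bijective_id, Matrix.one_mul, Matrix.submatrix_one_equiv])
  conv_lhs => rw [← h1]
  rw [integral_map (measurable_mulVec _).aemeasurable (by fun_prop)]
  refine integral_congr_ae (ae_of_all _ fun w => ?_)
  have : (Q *ᵥ w) i = w j := by
    simp [Q, Matrix.mulVec, dotProduct, Matrix.one_apply]
  simp only [this]

/-- The second moments of a spherical distribution. -/
theorem integral_dotProduct_sq_spherical (hg : Measurable g)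
    (hm : ∀ i, MemLp (fun w : Fin n → ℝ => w i) 2 (ellipticalMeasure 0 1 g))
    (i₀ : Fin n) (a : Fin n → ℝ) :
    ∫ w, (a ⬝ᵥ w) ^ 2 ∂(ellipticalMeasure 0 1 g) =
      (∫ w, w i₀ * w i₀ ∂(ellipticalMeasure 0 (1 : Matrix (Fin n) (Fin n) ℝ) g)) * (a ⬝ᵥ a) := by
  have h1 : ∀ w : Fin n → ℝ, (a ⬝ᵥ w) ^ 2 = ∑ i, ∑ j, (a i * a j) * (w i * w j) := fun w => by
    rw [sq, dotProduct, Finset.sum_mul_sum]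
    exact Finset.sum_congr rfl fun i _ => Finset.sum_congr rfl fun j _ => by ring
  have hI : ∀ i j, Integrable (fun w : Fin n → ℝ => (a i * a j) * (w i * w j))
      (ellipticalMeasure 0 1 g) := fun i j => ((hm i).integrable_mul (hm j)).const_mul _
  simp only [h1]
  rw [integral_finsetSum _ fun i _ => integrable_finsetSum _ fun j _ => hI i j, dotProduct,
    Finset.mul_sum]
  refine Finset.sum_congr rfl fun i _ => ?_
  rw [integral_finsetSum _ fun j _ => hI i j, Finset.sum_eq_single i]
  · rw [integral_const_mul, integral_coord_sq_eq hg i i₀, mul_comm]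
  · intro j _ hj
    rw [integral_const_mul, integral_coord_mul_coord hg hj.symm, mul_zero]
  · simp

theorem ae_coord_ne_zero_spherical (i : Fin n) :
    ∀ᵐ w ∂(ellipticalMeasure 0 (1 : Matrix (Fin n) (Fin n) ℝ) g), w i ≠ 0 := by
  refine (withDensity_absolutelyContinuous _ _).ae_le ?_
  change ∀ᵐ w : Fin n → ℝ, w i ≠ 0
  rw [ae_iff]
  simpa [volume_pi] using Measure.pi_hyperplane (fun _ : Fin n => (volume : Measure ℝ)) i 0

end Spherical

/-! ### Even and odd parts under a measure preserving map -/

section Symmetrization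

variable {Z : Type*} [MeasurableSpace Z] {ρ : Measure Z} {N : Z → Z} {u s : Z → ℝ}

theorem integral_eq_zero_of_odd (hN : MeasurePreserving N ρ ρ) (hs : AEStronglyMeasurable s ρ)
    (h : ∀ z, s (N z) = -s z) : ∫ z, s z ∂ρ = 0 := by
  have h1 : ∫ z, s (N z) ∂ρ = ∫ z, s z ∂ρ := by
    conv_rhs => rw [← hN.map_eq]
    rw [integral_map hN.measurable.aemeasurable (by rwa [hN.map_eq])]
  simp only [h, integral_neg] at h1
  linarith

/-- The parts of a square integrable function that are even and odd with respect to a measure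
preserving map are square integrable. -/
theorem memLp_even_odd (hN : MeasurePreserving N ρ ρ) (hu : ∀ z, u (N z) = u z)
    (hs : ∀ z, s (N z) = -s z) (h : MemLp (fun z => u z + s z) 2 ρ) :
    MemLp u 2 ρ ∧ MemLp s 2 ρ := by
  have h' : MemLp (fun z => u z - s z) 2 ρ := by
    -- Composition with `N` turns `u + s` into `u - s`; half the sum and half the difference recover
    -- the parts.
    have := h.comp_measurePreserving hN
    simpa only [Function.comp_def, hu, hs, ← sub_eq_add_neg] using this
  constructor
  · convert (h.add h').const_mul (1 / 2 : ℝ) using 1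
    ext z
    simp only [Pi.add_apply]
    ring
  · convert (h.sub h').const_mul (1 / 2 : ℝ) using 1
    ext z
    simp only [Pi.sub_apply]
    ring

theorem integral_even_add_odd [IsFiniteMeasure ρ] (hN : MeasurePreserving N ρ ρ)
    (hu : ∀ z, u (N z) = u z) (hs : ∀ z, s (N z) = -s z)
    (h : MemLp (fun z => u z + s z) 2 ρ) :
    ∫ z, u z + s z ∂ρ = ∫ z, u z ∂ρ := by
  obtain ⟨h1, h2⟩ := memLp_even_odd hN hu hs h
  rw [integral_add (h1.integrable one_le_two) (h2.integrable one_le_two),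
    integral_eq_zero_of_odd hN h2.1 hs, add_zero]

/-- The cross term `u s` is odd, so its integral vanishes. -/
theorem integral_even_add_odd_sq (hN : MeasurePreserving N ρ ρ)
    (hu : ∀ z, u (N z) = u z) (hs : ∀ z, s (N z) = -s z)
    (h : MemLp (fun z => u z + s z) 2 ρ) :
    ∫ z, (u z + s z) ^ 2 ∂ρ = ∫ z, u z ^ 2 ∂ρ + ∫ z, s z ^ 2 ∂ρ := by
  obtain ⟨h1, h2⟩ := memLp_even_odd hN hu hs h
  have h12 : Integrable (fun z => u z * s z) ρ := h1.integrable_mul h2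
  have e : ∀ z, (u z + s z) ^ 2 = (u z ^ 2 + s z ^ 2) + 2 * (u z * s z) := fun z => by ring
  simp only [e]
  have h3 : Integrable (fun z => u z ^ 2 + s z ^ 2) ρ := h1.integrable_sq.add h2.integrable_sq
  rw [integral_add h3 (h12.const_mul 2),
    integral_add h1.integrable_sq h2.integrable_sq, integral_const_mul,
    integral_eq_zero_of_odd hN h12.1 fun z => by rw [hu, hs, mul_neg]]
  ring

end Symmetrization

/-! ### Moments of mixtures and necessity -/

/-- The location-scale mixing map of a matrix. -/
def mixingMap {n q : ℕ} (μ δ : Fin n → ℝ) (α β : (Fin q → ℝ) → ℝ)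
    (A : Matrix (Fin n) (Fin n) ℝ) (p : (Fin n → ℝ) × (Fin q → ℝ)) : Fin n → ℝ :=
  μ + α p.2 • A *ᵥ p.1 + β p.2 • δ

section Mixing

variable {n q : ℕ} {g : ℝ → ℝ} {α β : (Fin q → ℝ) → ℝ}
  {H : Measure (Fin q → ℝ)} {μ δ μ₁ μ₂ δ₁ δ₂ : Fin n → ℝ}

theorem measurable_mixingMap (hα : Measurable α) (hβ : Measurable β)
    (A : Matrix (Fin n) (Fin n) ℝ) : Measurable (mixingMap μ δ α β A) := by
  have := measurable_mulVec A
  unfold mixingMap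
  fun_prop

/-- Separates the part even under `w ↦ -w` (location and skewness) from the odd part (scale). -/
theorem dotProduct_mixingMap (v : Fin n → ℝ) (A : Matrix (Fin n) (Fin n) ℝ)
    (p : (Fin n → ℝ) × (Fin q → ℝ)) :
    v ⬝ᵥ mixingMap μ δ α β A p = (v ⬝ᵥ μ + β p.2 * (v ⬝ᵥ δ)) + α p.2 * ((Aᵀ *ᵥ v) ⬝ᵥ p.1) := by
  rw [mixingMap, dotProduct_add, dotProduct_add, dotProduct_smul, dotProduct_smul, smul_eq_mul,
    smul_eq_mul, Matrix.mulVec_transpose, ← Matrix.dotProduct_mulVec]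
  ring

theorem measurePreserving_neg_prod [SFinite H] (hg : Measurable g)
    [IsFiniteMeasure (ellipticalMeasure 0 (1 : Matrix (Fin n) (Fin n) ℝ) g)] :
    MeasurePreserving (fun p : (Fin n → ℝ) × (Fin q → ℝ) => (-p.1, p.2))
      ((ellipticalMeasure 0 1 g).prod H) ((ellipticalMeasure 0 1 g).prod H) :=
  (measurePreserving_neg_spherical hg).prod (MeasurePreserving.id H)

theorem memLp_mixingMap_parts [SFinite H] (hg : Measurable g)
    [IsFiniteMeasure (ellipticalMeasure 0 (1 : Matrix (Fin n) (Fin n) ℝ) g)]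
    {A : Matrix (Fin n) (Fin n) ℝ}
    (h : MemLp (mixingMap μ δ α β A) 2 ((ellipticalMeasure 0 1 g).prod H)) (v : Fin n → ℝ) :
    MemLp (fun p : (Fin n → ℝ) × (Fin q → ℝ) => v ⬝ᵥ μ + β p.2 * (v ⬝ᵥ δ)) 2
        ((ellipticalMeasure 0 1 g).prod H) ∧
      MemLp (fun p : (Fin n → ℝ) × (Fin q → ℝ) => α p.2 * ((Aᵀ *ᵥ v) ⬝ᵥ p.1)) 2
        ((ellipticalMeasure 0 1 g).prod H) := by
  have h' := memLp_dotProduct h v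
  simp only [dotProduct_mixingMap] at h'
  exact memLp_even_odd (measurePreserving_neg_prod hg) (fun p => rfl) (fun p => by simp) h'

theorem integral_dotProduct_mixingMap [IsFiniteMeasure H] (hg : Measurable g)
    [IsFiniteMeasure (ellipticalMeasure 0 (1 : Matrix (Fin n) (Fin n) ℝ) g)]
    {A : Matrix (Fin n) (Fin n) ℝ}
    (h : MemLp (mixingMap μ δ α β A) 2 ((ellipticalMeasure 0 1 g).prod H)) (v : Fin n → ℝ) :
    ∫ p, v ⬝ᵥ mixingMap μ δ α β A p ∂((ellipticalMeasure 0 1 g).prod H) =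
      ∫ p : (Fin n → ℝ) × (Fin q → ℝ), v ⬝ᵥ μ + β p.2 * (v ⬝ᵥ δ)
        ∂((ellipticalMeasure 0 1 g).prod H) := by
  have h' := memLp_dotProduct h v
  simp only [dotProduct_mixingMap] at h' ⊢
  exact integral_even_add_odd (measurePreserving_neg_prod hg) (fun p => rfl) (fun p => by simp) h'

theorem integral_dotProduct_mixingMap_sq [SFinite H] (hg : Measurable g)
    [IsFiniteMeasure (ellipticalMeasure 0 (1 : Matrix (Fin n) (Fin n) ℝ) g)]
    {A : Matrix (Fin n) (Fin n) ℝ}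
    (h : MemLp (mixingMap μ δ α β A) 2 ((ellipticalMeasure 0 1 g).prod H)) (v : Fin n → ℝ) :
    ∫ p, (v ⬝ᵥ mixingMap μ δ α β A p) ^ 2 ∂((ellipticalMeasure 0 1 g).prod H) =
      ∫ p : (Fin n → ℝ) × (Fin q → ℝ), (v ⬝ᵥ μ + β p.2 * (v ⬝ᵥ δ)) ^ 2
        ∂((ellipticalMeasure 0 1 g).prod H) +
        (∫ w, ((Aᵀ *ᵥ v) ⬝ᵥ w) ^ 2 ∂(ellipticalMeasure 0 1 g)) * ∫ z, α z ^ 2 ∂H := by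
  have h' := memLp_dotProduct h v
  simp only [dotProduct_mixingMap] at h' ⊢
  rw [integral_even_add_odd_sq (measurePreserving_neg_prod hg) (fun p => rfl)
    (fun p => by simp) h', ← integral_prod_mul]
  congr 1
  refine integral_congr_ae (ae_of_all _ fun p => ?_)
  simp only
  ring

variable [IsProbabilityMeasure H]
  [IsProbabilityMeasure (ellipticalMeasure 0 (1 : Matrix (Fin n) (Fin n) ℝ) g)]

/-- Square integrability of a mixture with nontrivial scale passes to the spherical factor. -/
theorem memLp_coord_of_memLp_mixingMap (hg : Measurable g) {A : Matrix (Fin n) (Fin n) ℝ}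
    (hA : A.det ≠ 0) (hα0 : ¬ ∀ᵐ z ∂H, α z = 0)
    (h : MemLp (mixingMap μ δ α β A) 2 ((ellipticalMeasure 0 1 g).prod H)) (i : Fin n) :
    MemLp (fun w : Fin n → ℝ => w i) 2 (ellipticalMeasure 0 1 g) ∧
      Integrable (fun z => α z ^ 2) H := by
  have hu : IsUnit Aᵀ.det := by simpa using isUnit_iff_ne_zero.mpr hA
  -- The choice `v = (Aᵀ)⁻¹ eᵢ` makes the odd part exactly `α(z) wᵢ`.
  have h1 := (memLp_mixingMap_parts hg h ((Aᵀ)⁻¹ *ᵥ Pi.single i 1)).2.integrable_sq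
  simp only [Matrix.mulVec_mulVec, Matrix.mul_nonsing_inv _ hu, Matrix.one_mulVec,
    single_one_dotProduct, mul_pow] at h1
  constructor
  -- By Fubini almost every section of `α(z)² wᵢ²` is integrable; a section with `α(z) ≠ 0` is
  -- divided by that constant. The second claim uses a section with `wᵢ ≠ 0`.
  · obtain ⟨z, hz, hz0⟩ := (h1.prod_left_ae.and_frequently (not_eventually.1 hα0)).exists
    have h2 := hz.const_mul ((α z ^ 2)⁻¹)
    rw [memLp_two_iff_integrable_sq (continuous_apply i).aestronglyMeasurable]
    convert h2 using 1
    ext w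
    field_simp
  · obtain ⟨w, hw, hw0⟩ := (h1.prod_right_ae.and (ae_coord_ne_zero_spherical i)).exists
    have h2 := hw.mul_const ((w i ^ 2)⁻¹)
    convert h2 using 1
    ext z
    field_simp

/-- The scale matrices are ordered if the second moments of nonnegative linear functionals are. -/
theorem copositive_of_integral_sq_le (hg : Measurable g) {A₁ A₂ : Matrix (Fin n) (Fin n) ℝ}
    (hA₁ : A₁.det ≠ 0) (hα0 : ¬ ∀ᵐ z ∂H, α z = 0)
    (h₁ : MemLp (mixingMap μ δ α β A₁) 2 ((ellipticalMeasure 0 1 g).prod H))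
    (h₂ : MemLp (mixingMap μ δ α β A₂) 2 ((ellipticalMeasure 0 1 g).prod H))
    (h : ∀ v : Fin n → ℝ, (∀ i, 0 ≤ v i) →
      ∫ p, (v ⬝ᵥ mixingMap μ δ α β A₁ p) ^ 2 ∂((ellipticalMeasure 0 1 g).prod H) ≤
        ∫ p, (v ⬝ᵥ mixingMap μ δ α β A₂ p) ^ 2 ∂((ellipticalMeasure 0 1 g).prod H)) :
    Copositive (A₂ * A₂ᵀ - A₁ * A₁ᵀ) := by
  intro v hv
  rcases isEmpty_or_nonempty (Fin n) with hn | ⟨⟨i₀⟩⟩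
  · simp [dotProduct]
  have hm := fun i => (memLp_coord_of_memLp_mixingMap hg hA₁ hα0 h₁ i).1
  have hαi := (memLp_coord_of_memLp_mixingMap hg hA₁ hα0 h₁ i₀).2
  have key := h v hv
  -- The location and skewness terms coincide and cancel, leaving `κ E[α²]` times the two quadratic
  -- forms, with `κ = E[wᵢ₀²]`.
  rw [integral_dotProduct_mixingMap_sq hg h₁, integral_dotProduct_mixingMap_sq hg h₂,
    add_le_add_iff_left, integral_dotProduct_sq_spherical hg hm i₀,
    integral_dotProduct_sq_spherical hg hm i₀] at key
  have hα2 : 0 < ∫ z, α z ^ 2 ∂H := by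
    refine lt_of_le_of_ne (integral_nonneg fun z => sq_nonneg _) fun h0 => hα0 ?_
    have := (integral_eq_zero_iff_of_nonneg (fun z => sq_nonneg (α z)) hαi).1 h0.symm
    filter_upwards [this] with z hz
    simpa using hz
  have hκ : 0 < ∫ w, w i₀ * w i₀ ∂(ellipticalMeasure 0 (1 : Matrix (Fin n) (Fin n) ℝ) g) := by
    refine lt_of_le_of_ne (integral_nonneg fun w => mul_self_nonneg _) fun h0 => ?_
    have := (integral_eq_zero_iff_of_nonneg (fun w : Fin n → ℝ => mul_self_nonneg (w i₀))
      ((hm i₀).integrable_mul (hm i₀))).1 h0.symm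
    obtain ⟨w, hw, hw0⟩ := (this.and (ae_coord_ne_zero_spherical i₀)).exists
    exact hw0 (by simpa using hw)
  have hle := le_of_mul_le_mul_left (le_of_mul_le_mul_right key hα2) hκ
  have e : ∀ A : Matrix (Fin n) (Fin n) ℝ,
      (Aᵀ *ᵥ v) ⬝ᵥ (Aᵀ *ᵥ v) = v ⬝ᵥ ((A * Aᵀ) *ᵥ v) := fun A => by
    rw [← Matrix.mulVec_mulVec, Matrix.dotProduct_mulVec v, ← Matrix.mulVec_transpose]
  rw [e, e] at hle
  rw [Matrix.sub_mulVec, dotProduct_sub]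
  linarith

/-- Mixtures with equal locations and equal means have equal skewness directions. -/
theorem skewness_eq_of_integral_eq (hg : Measurable g) (hβ : Measurable β) (hβ0 : ∀ z, 0 ≤ β z)
    (hβ1 : ¬ ∀ᵐ z ∂H, β z = 0) {A₁ A₂ : Matrix (Fin n) (Fin n) ℝ}
    (h₁ : MemLp (mixingMap μ δ₁ α β A₁) 2 ((ellipticalMeasure 0 1 g).prod H))
    (h₂ : MemLp (mixingMap μ δ₂ α β A₂) 2 ((ellipticalMeasure 0 1 g).prod H))
    (h : ∀ v : Fin n → ℝ,
      ∫ p, v ⬝ᵥ mixingMap μ δ₁ α β A₁ p ∂((ellipticalMeasure 0 1 g).prod H) =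
        ∫ p, v ⬝ᵥ mixingMap μ δ₂ α β A₂ p ∂((ellipticalMeasure 0 1 g).prod H)) :
    δ₁ = δ₂ := by
  ext i
  by_contra hne
  have hne' : δ₁ i - δ₂ i ≠ 0 := sub_ne_zero.2 hne
  have key := h (Pi.single i 1)
  rw [integral_dotProduct_mixingMap hg h₁, integral_dotProduct_mixingMap hg h₂] at key
  have i₁ := (memLp_mixingMap_parts hg h₁ (Pi.single i 1)).1.integrable one_le_two
  have i₂ := (memLp_mixingMap_parts hg h₂ (Pi.single i 1)).1.integrable one_le_two
  simp only [single_one_dotProduct] at key i₁ i₂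
  have e : ∀ p : (Fin n → ℝ) × (Fin q → ℝ),
      (μ i + β p.2 * δ₁ i) - (μ i + β p.2 * δ₂ i) = β p.2 * (δ₁ i - δ₂ i) := fun p => by ring
  have h0 : ∫ p, β p.2 * (δ₁ i - δ₂ i)
      ∂((ellipticalMeasure 0 (1 : Matrix (Fin n) (Fin n) ℝ) g).prod H) = 0 := by
    simp only [← e]
    rw [integral_sub i₁ i₂, key, sub_self]
  have hi := i₁.sub i₂
  -- Integrability of `β` is recovered from the difference of the two integrands, since `δ₁ i ≠ δ₂
  -- i`.
  have hi' : Integrable (fun p : (Fin n → ℝ) × (Fin q → ℝ) => β p.2)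
      ((ellipticalMeasure 0 1 g).prod H) := by
    convert hi.mul_const (δ₁ i - δ₂ i)⁻¹ using 1
    ext p
    rw [Pi.sub_apply, e]
    field_simp
  rw [integral_mul_const] at h0
  have h0' := (integral_eq_zero_iff_of_nonneg
    (fun p : (Fin n → ℝ) × (Fin q → ℝ) => hβ0 p.2) hi').1 ((mul_eq_zero.1 h0).resolve_right hne')
  refine hβ1 ?_
  have hmp := measurePreserving_snd
    (μ := ellipticalMeasure 0 (1 : Matrix (Fin n) (Fin n) ℝ) g) (ν := H)
  have hset : MeasurableSet {z | β z = 0} := hβ (measurableSet_singleton 0)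
  rw [← hmp.map_eq, ae_map_iff measurable_snd.aemeasurable hset]
  exact h0'

/-- Mixtures with equal skewness directions and equal means have equal locations. -/
theorem location_eq_of_integral_eq (hg : Measurable g) {A₁ A₂ : Matrix (Fin n) (Fin n) ℝ}
    (h₁ : MemLp (mixingMap μ₁ δ α β A₁) 2 ((ellipticalMeasure 0 1 g).prod H))
    (h₂ : MemLp (mixingMap μ₂ δ α β A₂) 2 ((ellipticalMeasure 0 1 g).prod H))
    (h : ∀ v : Fin n → ℝ,
      ∫ p, v ⬝ᵥ mixingMap μ₁ δ α β A₁ p ∂((ellipticalMeasure 0 1 g).prod H) =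
        ∫ p, v ⬝ᵥ mixingMap μ₂ δ α β A₂ p ∂((ellipticalMeasure 0 1 g).prod H)) :
    μ₁ = μ₂ := by
  ext i
  have key := h (Pi.single i 1)
  rw [integral_dotProduct_mixingMap hg h₁, integral_dotProduct_mixingMap hg h₂] at key
  have i₁ := (memLp_mixingMap_parts hg h₁ (Pi.single i 1)).1.integrable one_le_two
  have i₂ := (memLp_mixingMap_parts hg h₂ (Pi.single i 1)).1.integrable one_le_two
  simp only [single_one_dotProduct] at key i₁ i₂
  -- The `β` terms cancel pointwise, so `β` itself need not be integrable.
  rw [← sub_eq_zero, ← integral_sub i₁ i₂] at key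
  simpa [sub_eq_zero] using key

end Mixing

end LSE

end

/-! ### Assembly of the three statements -/

theorem mainTheorem8 {n q : ℕ} (hn : 0 < n)
    {Ω₁ Ω₂ : Type*} [MeasurableSpace Ω₁] [MeasurableSpace Ω₂]
    (P₁ : Measure Ω₁) (P₂ : Measure Ω₂) [IsProbabilityMeasure P₁] [IsProbabilityMeasure P₂]
    (Y₁ : Ω₁ → Fin n → ℝ) (Y₂ : Ω₂ → Fin n → ℝ)
    (μ₁ μ₂ δ₁ δ₂ : Fin n → ℝ) (S₁ S₂ : Matrix (Fin n) (Fin n) ℝ)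
    (hS₁ : S₁.PosDef) (hS₂ : S₂.PosDef)
    (g : ℝ → ℝ) (hg : LSE.IsDensityGenerator n g)
    (α β : (Fin q → ℝ) → ℝ) (hα : Measurable α) (hβ : Measurable β)
    (hα0 : ∀ z, 0 ≤ α z) (hβ0 : ∀ z, 0 ≤ β z)
    (H : Measure (Fin q → ℝ)) [IsProbabilityMeasure H]
    (hY₁ : HasLaw Y₁ (LSE.lseMeasure μ₁ S₁ δ₁ g α β H) P₁)
    (hY₂ : HasLaw Y₂ (LSE.lseMeasure μ₂ S₂ δ₂ g α β H) P₂) :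
    (μ₁ = μ₂ → δ₁ = δ₂ → LSE.Copositive (S₂ - S₁) → LSE.CPOrder Y₁ P₁ Y₂ P₂) ∧
    (MemLp Y₁ 2 P₁ → MemLp Y₂ 2 P₂ → ¬ (∀ᵐ z ∂H, α z = 0) → ¬ (∀ᵐ z ∂H, β z = 0) →
      μ₁ = μ₂ →
        (LSE.CPOrder Y₁ P₁ Y₂ P₂ ↔ δ₁ = δ₂ ∧ LSE.Copositive (S₂ - S₁))) ∧
    (MemLp Y₁ 2 P₁ → MemLp Y₂ 2 P₂ → ¬ (∀ᵐ z ∂H, α z = 0) →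
      δ₁ = δ₂ →
        (LSE.CPOrder Y₁ P₁ Y₂ P₂ ↔ μ₁ = μ₂ ∧ LSE.Copositive (S₂ - S₁))) := by
  obtain ⟨B, d, hB, hd, e₁, e₂⟩ := LSE.exists_simultaneous_diagonalization hS₁ hS₂
  set B₂ := B * Matrix.diagonal fun i => Real.sqrt (d i) with hB₂
  have hB₂det : B₂.det ≠ 0 := by
    rw [hB₂, Matrix.det_mul, Matrix.det_diagonal]
    exact mul_ne_zero hB (Finset.prod_ne_zero_iff.2 fun i _ => (Real.sqrt_pos.2 (hd i)).ne')
  have e₂' : S₂ = B₂ * B₂.transpose := by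
    have hdd : Matrix.diagonal d = (Matrix.diagonal fun i => Real.sqrt (d i)) *
        Matrix.diagonal fun i => Real.sqrt (d i) := by
      rw [Matrix.diagonal_mul_diagonal]
      congr 1
      ext1 i
      exact (Real.mul_self_sqrt (hd i).le).symm
    rw [e₂, hB₂, Matrix.transpose_mul, Matrix.diagonal_transpose, hdd]
    simp only [Matrix.mul_assoc]
  have hgm := hg.measurable
  -- The total mass needs no polar coordinates: the law of `Y₁` is a probability measure and an
  -- image of the product of the spherical law with `H`, so the spherical law has mass one.
  have hprob : IsProbabilityMeasure
      (LSE.ellipticalMeasure 0 (1 : Matrix (Fin n) (Fin n) ℝ) g) := by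
    have h := hY₁.isProbabilityMeasure_iff.1 inferInstance
    rw [e₁, LSE.lseMeasure_mul_transpose μ₁ δ₁ B hB hgm hα hβ] at h
    have hsf : SFinite (LSE.ellipticalMeasure 0 (1 : Matrix (Fin n) (Fin n) ℝ) g) := by
      rw [LSE.ellipticalMeasure]; infer_instance
    have h' := (Measure.isProbabilityMeasure_map_iff
      (LSE.measurable_mixingMap (μ := μ₁) (δ := δ₁) hα hβ B).aemeasurable).1 h
    refine ⟨?_⟩
    have h1 := h'.measure_univ
    rwa [← univ_prod_univ, Measure.prod_prod, measure_univ (μ := H), mul_one] at h1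
  rw [e₁, LSE.lseMeasure_mul_transpose μ₁ δ₁ B hB hgm hα hβ] at hY₁
  rw [e₂', LSE.lseMeasure_mul_transpose μ₂ δ₂ B₂ hB₂det hgm hα hβ] at hY₂
  have hT₁ := LSE.measurable_mixingMap (μ := μ₁) (δ := δ₁) hα hβ B
  have hT₂ := LSE.measurable_mixingMap (μ := μ₂) (δ := δ₂) hα hβ B₂
  have part1 : μ₁ = μ₂ → δ₁ = δ₂ → LSE.Copositive (S₂ - S₁) → LSE.CPOrder Y₁ P₁ Y₂ P₂ := by
    rintro rfl rfl hc
    rw [e₁, e₂] at hc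
    exact LSE.cpOrder_of_copositive hg μ₁ δ₁ hd hc hα hβ hα0 hβ0 H hY₁ hY₂
  have copos : MemLp Y₁ 2 P₁ → MemLp Y₂ 2 P₂ → ¬ (∀ᵐ z ∂H, α z = 0) → μ₁ = μ₂ → δ₁ = δ₂ →
      LSE.CPOrder Y₁ P₁ Y₂ P₂ → LSE.Copositive (S₂ - S₁) := by
    rintro m₁ m₂ hα1 rfl rfl h
    rw [e₁, e₂']
    exact LSE.copositive_of_integral_sq_le hgm hB hα1 (LSE.memLp_of_hasLaw_map hT₁ hY₁ m₁)
      (LSE.memLp_of_hasLaw_map hT₂ hY₂ m₂) fun v hv =>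
        h.integral_dotProduct_sq_le hT₁ hT₂ hY₁ hY₂ m₁ m₂ hv
  refine ⟨part1, fun m₁ m₂ hα1 hβ1 hμ => ⟨fun h => ?_, fun h => part1 hμ h.1 h.2⟩,
    fun m₁ m₂ hα1 hδ => ⟨fun h => ?_, fun h => part1 h.1 hδ h.2⟩⟩
  · have hδ : δ₁ = δ₂ := by
      subst hμ
      exact LSE.skewness_eq_of_integral_eq hgm hβ hβ0 hβ1 (LSE.memLp_of_hasLaw_map hT₁ hY₁ m₁)
        (LSE.memLp_of_hasLaw_map hT₂ hY₂ m₂) fun v =>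
          h.integral_dotProduct_eq hT₁ hT₂ hY₁ hY₂ m₁ m₂ v
    exact ⟨hδ, copos m₁ m₂ hα1 hμ hδ h⟩
  · have hμ : μ₁ = μ₂ := by
      subst hδ
      exact LSE.location_eq_of_integral_eq hgm (LSE.memLp_of_hasLaw_map hT₁ hY₁ m₁)
        (LSE.memLp_of_hasLaw_map hT₂ hY₂ m₂) fun v =>
          h.integral_dotProduct_eq hT₁ hT₂ hY₁ hY₂ m₁ m₂ v
    exact ⟨hμ, copos m₁ m₂ hα1 hμ hδ h⟩
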